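/- Let $\mathbb{D}$ be the open unit disc, $\mathbb{T}$ the unit circle, and let $\mathcal{D}_a$ be the space of functions that are analytic on $\mathbb{D}$ and smooth on $\overline{\mathbb{D}}$. For $f\in\mathcal{D}_a$ write $\hat f(0)=\frac{1}{2\pi}\int_0^{2\pi}f(e^{i\theta})\,d\theta$ and $(M_zf)(z)=zf(z)$. For a finite positive Borel measure $\mu$ on $\mathbb{T}$, with Poisson extension $P_\mu(z)=\int_{\mathbb{T}}\frac{1-|z|^2}{|\zeta-z|^2}\,d\mu(\zeta)$, put $\mathcal{D}_{\mu,0}(f)=\int_{\mathbb{T}}|f|^2\,d\mu$ and, for $n\ge 1$, $$\mathcal{D}_{\mu,n}(f)=\lim_{r\to1^-}\frac{1}{n!(n-1)!\,\pi}\int_{|z|<r}|f^{(n)}(z)|^2P_\mu(z)(1-|z|^2)^{n-1}\,dA(z).$$ For an $m$-tuple $\vec\mu=(\mu_0,\dots,\mu_{m-1})$, $m\ge1$, of such measures put $\|f\|_{\vec\mu}^2=\sum_{n=0}^{m-1}\mathcal{D}_{\mu_n,n}(f)$. The tuple is called allowable if there is $C>0$ with $0\le\|M_zf\|_{\vec\mu}^2\le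 C^2\|f\|_{\vec\mu}^2$ for all $f\in\mathcal{D}_a$. In that case $\mathcal{D}^2_{\vec\mu}$ denotes the Hilbert space completion of $\mathcal{D}_a/\ker\|\cdot\|_{\vec\mu}$, and $M_{\vec\mu}$ denotes the extension of $M_z$ to a bounded linear operator on $\mathcal{D}^2_{\vec\mu}$. A bounded operator $T$ on a complex Hilbert space is an $m$-isometry if $\sum_{j=0}^m(-1)^{m-j}\binom{m}{j}T^{*j}T^j=0$. **Theorem.** Let $\vec\mu=(\mu_0,\dots,\mu_{m-1})$ be an $m$-tuple of finite positive measures on $\mathbb{T}$ with $\mu_{m-1}\ne0$. (i) If $m=1$, then $\vec\mu$ is allowable. (ii) If $m\ge2$, and there is $C>0$ such that $|\hat f(0)|^2\le C\,\mathcal{D}_{\mu_0,0}(f)$ for all $f\in\mathcal{D}_a$, then $\vec\mu$ is allowable. In both cases, $M_{\vec\mu}$ is a (bounded) $m$-isometry, and it is norm-expanding: $\|x\|\le\|M_{\vec\mu}x\|$ for all $x\in\mathcal{D}^2_{\vec\mu}$. -/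

import Mathlib

open MeasureTheory Filter Topology
open scoped ContDiff ComplexConjugate

namespace DirichletModel

noncomputable section

/-- The unit circle `𝕋`, as a (Borel) measurable space. -/
abbrev UnitCircle : Type := Metric.sphere (0 : ℂ) 1

/-- The space `𝒟ₐ` of functions that are analytic on the open unit disc and smooth on its closure.
Elements are represented by functions on `ℂ`, whose values off the closed disc play no role: nothing
below depends on them. -/
def DA : Submodule ℂ (ℂ → ℂ) where
  carrier := {f | DifferentiableOn ℂ f (Metric.ball 0 1) ∧
    ContDiffOn ℝ ∞ f (Metric.closedBall 0 1)}
  add_mem' hf hg := ⟨hf.1.add hg.1, hf.2.add hg.2⟩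
  zero_mem' := ⟨differentiableOn_const 0, contDiffOn_const⟩
  smul_mem' c _ hf := ⟨hf.1.const_smul c, hf.2.const_smul c⟩

/-- The operator `M_z : 𝒟ₐ → 𝒟ₐ`, `(M_z f)(z) = z f(z)`. -/
def mulZ : DA →ₗ[ℂ] DA where
  toFun f := ⟨fun z => z * (f : ℂ → ℂ) z,
    differentiableOn_id.mul f.2.1, contDiffOn_id.mul f.2.2⟩
  map_add' f g := by ext z; simp [mul_add]
  map_smul' c f := by ext z; simp [mul_left_comm]

/-- The Fourier coefficient `f̂(k) = (1/2π) ∫_𝕋 f(ζ) ζ̄ᵏ |dζ|`. -/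
def fourierCoefficient (f : ℂ → ℂ) (k : ℤ) : ℂ :=
  (2 * Real.pi : ℂ)⁻¹ * ∫ θ in (0 : ℝ)..(2 * Real.pi),
    f (Complex.exp (θ * Complex.I)) * (conj (Complex.exp (θ * Complex.I))) ^ k

/-- The Poisson extension `P_μ(z) = ∫_𝕋 (1 - |z|²) / |ζ - z|² dμ(ζ)`. -/
def poissonExtension (μ : FiniteMeasure UnitCircle) (z : ℂ) : ℝ :=
  ∫ ζ : UnitCircle, poissonKernel 0 z (ζ : ℂ) ∂(μ : Measure UnitCircle)

/-- The weighted Dirichlet integral `𝒟_{μ,n}(f)` of order `n`: for `n = 0` it is `∫_𝕋 |f|² dμ`, and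
for `n ≥ 1` it is the limit, as `r → 1⁻`, of
`1 / (n! (n-1)! π) ∫_{|z| < r} |f⁽ⁿ⁾(z)|² P_μ(z) (1 - |z|²)ⁿ⁻¹ dA(z)`. -/
def dirichletIntegral (μ : FiniteMeasure UnitCircle) : ℕ → (ℂ → ℂ) → ℝ
  | 0, f => ∫ ζ : UnitCircle, ‖f ζ‖ ^ 2 ∂(μ : Measure UnitCircle)
  | n + 1, f => limUnder (𝓝[<] (1 : ℝ)) fun r =>
      1 / ((n + 1).factorial * n.factorial * Real.pi) *
        ∫ z in Metric.ball (0 : ℂ) r,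
          ‖iteratedDeriv (n + 1) f z‖ ^ 2 * poissonExtension μ z * (1 - ‖z‖ ^ 2) ^ n

/-- The quadratic form `‖f‖²_μ = ∑_{n < m} 𝒟_{μₙ,n}(f)` of an `m`-tuple. -/
def normSq {m : ℕ} (μ : Fin m → FiniteMeasure UnitCircle) (f : ℂ → ℂ) : ℝ :=
  ∑ n : Fin m, dirichletIntegral (μ n) n f

/-- The tuple is allowable: for some `C > 0`, `0 ≤ ‖M_z f‖²_μ ≤ C² ‖f‖²_μ` for all `f ∈ 𝒟ₐ`. -/
def Allowable {m : ℕ} (μ : Fin m → FiniteMeasure UnitCircle) : Prop :=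
  ∃ C : ℝ, 0 < C ∧ ∀ f : DA, 0 ≤ normSq μ (mulZ f) ∧ normSq μ (mulZ f) ≤ C ^ 2 * normSq μ f

/-! ### The Dirichlet integral as an `L²`-norm -/

lemma norm_le_poissonKernel {z ζ : ℂ} (hz : ‖z‖ < 1) (hζ : ‖ζ‖ = 1) :
    0 ≤ poissonKernel 0 z ζ ∧ poissonKernel 0 z ζ ≤ 2 * ‖z - ζ‖ ^ (-1 : ℝ) := by
  have h1 : 1 - ‖z‖ ≤ ‖z - ζ‖ := by
    have := norm_sub_norm_le ζ z
    rw [hζ, norm_sub_rev] at this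
    exact this
  have h2 : 0 < ‖z - ζ‖ := by linarith
  have h3 := norm_nonneg z
  simp only [poissonKernel_def, sub_zero, hζ]
  rw [norm_sub_rev ζ z, Real.rpow_neg_one, ← div_eq_mul_inv]
  refine ⟨div_nonneg (by nlinarith) (by positivity), ?_⟩
  rw [div_le_div_iff₀ (by positivity) h2]
  nlinarith [mul_le_mul_of_nonneg_right h1 h2.le]

lemma measurable_poissonKernel :
    Measurable fun p : ℂ × UnitCircle => poissonKernel 0 p.1 (p.2 : ℂ) := by
  simp only [poissonKernel_def]
  fun_prop

lemma integral_poissonKernel_le (ζ : UnitCircle) :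
    Integrable (fun z => poissonKernel 0 z (ζ : ℂ)) (volume.restrict (Metric.ball 0 1)) ∧
    ∫ z in Metric.ball (0 : ℂ) 1, ‖poissonKernel 0 z (ζ : ℂ)‖ ≤
      ∫ z in Metric.ball (0 : ℂ) 2, 2 * ‖z‖ ^ (-1 : ℝ) := by
  have hζ : ‖(ζ : ℂ)‖ = 1 := by simp
  have h0 : IntegrableOn (fun z : ℂ => 2 * ‖z‖ ^ (-1 : ℝ)) (Metric.ball 0 2) := by
    refine integrableOn_ball_of_norm_le_rpow (C := 2) (α := 1) (by simp) (by simp) ?_ ?_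
    · refine Eventually.of_forall fun z => ?_
      rw [Real.norm_of_nonneg (by positivity)]
    · exact (by fun_prop : Measurable fun z : ℂ => 2 * ‖z‖ ^ (-1 : ℝ)).aestronglyMeasurable
  have hpre : (fun z : ℂ => z - ζ) ⁻¹' Metric.ball 0 2 = Metric.ball (ζ : ℂ) 2 := by
    ext z; simp [dist_eq_norm]
  have hmp : MeasurePreserving (fun z : ℂ => z - ζ) (volume.restrict (Metric.ball (ζ : ℂ) 2))
      (volume.restrict (Metric.ball 0 2)) := by
    rw [← hpre]
    exact (measurePreserving_sub_right volume (ζ : ℂ)).restrict_preimage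
      Metric.isOpen_ball.measurableSet
  have hemb : MeasurableEmbedding (fun z : ℂ => z - ζ) :=
    (Homeomorph.subRight (ζ : ℂ)).measurableEmbedding
  have h1 : IntegrableOn (fun z : ℂ => 2 * ‖z - ζ‖ ^ (-1 : ℝ)) (Metric.ball (ζ : ℂ) 2) :=
    (hmp.integrable_comp_emb hemb (g := fun z : ℂ => 2 * ‖z‖ ^ (-1 : ℝ))).2 h0
  have hsub : Metric.ball (0 : ℂ) 1 ⊆ Metric.ball (ζ : ℂ) 2 := by
    intro z hz
    have hz' : ‖z‖ < 1 := by simpa using hz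
    have := norm_sub_le z (ζ : ℂ)
    simp only [Metric.mem_ball, dist_eq_norm]
    linarith
  have hle : ∀ᵐ z ∂(volume.restrict (Metric.ball (0 : ℂ) 1)),
      ‖poissonKernel 0 z (ζ : ℂ)‖ ≤ 2 * ‖z - ζ‖ ^ (-1 : ℝ) := by
    filter_upwards [ae_restrict_mem Metric.isOpen_ball.measurableSet] with z hz
    obtain ⟨ha, hb⟩ := norm_le_poissonKernel (by simpa using hz) hζ
    rwa [Real.norm_of_nonneg ha]
  have hint : Integrable (fun z => poissonKernel 0 z (ζ : ℂ))
      (volume.restrict (Metric.ball 0 1)) :=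
    (h1.mono_set hsub).mono'
      (measurable_poissonKernel.comp (measurable_id.prodMk measurable_const)).aestronglyMeasurable
      hle
  refine ⟨hint, (integral_mono_ae hint.norm (h1.mono_set hsub) hle).trans ?_⟩
  refine (setIntegral_mono_set h1 (Eventually.of_forall fun z => by positivity)
    hsub.eventuallyLE).trans (le_of_eq ?_)
  exact hmp.integral_comp hemb (fun z : ℂ => 2 * ‖z‖ ^ (-1 : ℝ))

lemma measurable_poissonExtension (μ : FiniteMeasure UnitCircle) :
    Measurable (poissonExtension μ) :=
  (measurable_poissonKernel.stronglyMeasurable.integral_prod_right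
    (ν := (μ : Measure UnitCircle))).measurable

lemma poissonExtension_nonneg (μ : FiniteMeasure UnitCircle) {z : ℂ} (hz : ‖z‖ < 1) :
    0 ≤ poissonExtension μ z :=
  integral_nonneg fun ζ => (norm_le_poissonKernel hz (by simp)).1

lemma integrable_poissonExtension (μ : FiniteMeasure UnitCircle) :
    IntegrableOn (poissonExtension μ) (Metric.ball 0 1) := by
  have h : Integrable (fun p : UnitCircle × ℂ => poissonKernel 0 p.2 (p.1 : ℂ))
      ((μ : Measure UnitCircle).prod (volume.restrict (Metric.ball 0 1))) := by
    have hm : Measurable fun p : UnitCircle × ℂ => poissonKernel 0 p.2 (p.1 : ℂ) :=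
      by simp only [poissonKernel_def]; fun_prop
    refine (integrable_prod_iff hm.aestronglyMeasurable).2
      ⟨Eventually.of_forall fun ζ => (integral_poissonKernel_le ζ).1, ?_⟩
    refine Integrable.mono' (integrable_const
      (∫ z in Metric.ball (0 : ℂ) 2, 2 * ‖z‖ ^ (-1 : ℝ))) ?_ ?_
    · exact (hm.norm.stronglyMeasurable.integral_prod_right).aestronglyMeasurable
    · refine Eventually.of_forall fun ζ => ?_
      rw [Real.norm_of_nonneg (integral_nonneg fun _ => norm_nonneg _)]
      exact (integral_poissonKernel_le ζ).2
  exact h.integral_prod_right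

/-- The derivatives of `f ∈ 𝒟ₐ` are bounded on the open disc. -/
lemma exists_bound_iteratedDeriv (f : DA) (n : ℕ) :
    ∃ C : ℝ, ∀ z ∈ Metric.ball (0 : ℂ) 1, ‖iteratedDeriv n (f : ℂ → ℂ) z‖ ≤ C := by
  have hu : UniqueDiffOn ℝ (Metric.closedBall (0 : ℂ) 1) :=
    uniqueDiffOn_convex (convex_closedBall _ _)
      ⟨0, by rw [interior_closedBall _ one_ne_zero]; simp⟩
  have hc := f.2.2.continuousOn_iteratedFDerivWithin (m := n) (by exact_mod_cast le_top) hu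
  obtain ⟨C, hC⟩ := (isCompact_closedBall (0 : ℂ) 1).exists_bound_of_continuousOn hc
  refine ⟨C, fun z hz => ?_⟩
  have h1 := hC z (Metric.ball_subset_closedBall hz)
  have hnhds : Metric.closedBall (0 : ℂ) 1 ∈ 𝓝 z :=
    mem_of_superset (Metric.isOpen_ball.mem_nhds hz) Metric.ball_subset_closedBall
  have h2 : iteratedFDerivWithin ℝ n (f : ℂ → ℂ) (Metric.closedBall 0 1) z =
      iteratedFDeriv ℝ n (f : ℂ → ℂ) z :=
    iteratedFDerivWithin_eq_iteratedFDeriv hu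
      ((f.2.2.contDiffAt hnhds).of_le (by exact_mod_cast le_top))
      (Metric.ball_subset_closedBall hz)
  have h3 : ContDiffAt ℂ n (f : ℂ → ℂ) z :=
    ((f.2.1.analyticAt (Metric.isOpen_ball.mem_nhds hz)).contDiffAt)
  have h4 := h3.restrictScalars_iteratedFDeriv (𝕜 := ℝ)
  rw [h2, ← h4] at h1
  rw [← norm_iteratedFDeriv_eq_norm_iteratedDeriv]
  simpa using h1

lemma continuousOn_iteratedDeriv (f : DA) (n : ℕ) :
    ContinuousOn (iteratedDeriv n (f : ℂ → ℂ)) (Metric.ball (0 : ℂ) 1) := by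
  intro z hz
  have h3 : AnalyticAt ℂ (f : ℂ → ℂ) z := f.2.1.analyticAt (Metric.isOpen_ball.mem_nhds hz)
  exact (h3.iterated_deriv n |>.continuousAt.continuousWithinAt.congr
    (fun y _ => by rw [iteratedDeriv_eq_iterate]) (by rw [iteratedDeriv_eq_iterate]))

lemma continuous_restrict_circle (f : DA) : Continuous fun ζ : UnitCircle => (f : ℂ → ℂ) ζ := by
  have h : ContinuousOn (f : ℂ → ℂ) (Metric.sphere 0 1) :=
    f.2.2.continuousOn.mono Metric.sphere_subset_closedBall
  exact continuousOn_iff_continuous_domRestrict.1 h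

/-- The measure on `ℂ` such that `𝒟_{μ,n}(f)` is the integral of `|f⁽ⁿ⁾|²`. -/
def weightMeasure (μ : FiniteMeasure UnitCircle) : ℕ → Measure ℂ
  | 0 => (μ : Measure UnitCircle).map (fun ζ : UnitCircle => (ζ : ℂ))
  | n + 1 => (volume.restrict (Metric.ball 0 1)).withDensity fun z => ENNReal.ofReal
      (1 / ((n + 1).factorial * n.factorial * Real.pi) *
        (poissonExtension μ z * (1 - ‖z‖ ^ 2) ^ n))

lemma measurable_weight (μ : FiniteMeasure UnitCircle) (n : ℕ) :
    Measurable fun z : ℂ => 1 / ((n + 1).factorial * n.factorial * Real.pi) *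
        (poissonExtension μ z * (1 - ‖z‖ ^ 2) ^ n) := by
  have := measurable_poissonExtension μ
  fun_prop

lemma weight_nonneg (μ : FiniteMeasure UnitCircle) (n : ℕ) {z : ℂ}
    (hz : z ∈ Metric.ball (0 : ℂ) 1) : 0 ≤ 1 / ((n + 1).factorial * n.factorial * Real.pi) *
        (poissonExtension μ z * (1 - ‖z‖ ^ 2) ^ n) := by
  have hz' : ‖z‖ < 1 := by simpa using hz
  have h1 := poissonExtension_nonneg μ hz'
  have h2 : 0 ≤ 1 - ‖z‖ ^ 2 := by nlinarith [norm_nonneg z]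
  have := Real.pi_pos
  positivity

lemma integrable_weight (μ : FiniteMeasure UnitCircle) (n : ℕ) :
    IntegrableOn (fun z : ℂ => 1 / ((n + 1).factorial * n.factorial * Real.pi) *
        (poissonExtension μ z * (1 - ‖z‖ ^ 2) ^ n)) (Metric.ball 0 1) := by
  refine Integrable.const_mul ?_ _
  refine (integrable_poissonExtension μ).mul_bdd (c := 1) ?_ ?_
  · exact (by fun_prop : Measurable fun z : ℂ => (1 - ‖z‖ ^ 2) ^ n).aestronglyMeasurable
  · filter_upwards [ae_restrict_mem Metric.isOpen_ball.measurableSet] with z hz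
    have hz' : ‖z‖ < 1 := by simpa using hz
    have h2 : 0 ≤ 1 - ‖z‖ ^ 2 := by nlinarith [norm_nonneg z]
    rw [Real.norm_of_nonneg (by positivity)]
    exact pow_le_one₀ h2 (by nlinarith [norm_nonneg z])

instance (μ : FiniteMeasure UnitCircle) (n : ℕ) : IsFiniteMeasure (weightMeasure μ n) := by
  cases n with
  | zero => unfold weightMeasure; infer_instance
  | succ n => exact isFiniteMeasure_withDensity_ofReal (integrable_weight μ n).2

lemma memLp_iteratedDeriv (μ : FiniteMeasure UnitCircle) (n : ℕ) (f : DA) :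
    MemLp (iteratedDeriv n (f : ℂ → ℂ)) 2 (weightMeasure μ n) := by
  cases n with
  | zero =>
    have he : MeasurableEmbedding (fun ζ : UnitCircle => (ζ : ℂ)) :=
      MeasurableEmbedding.subtype_coe Metric.isClosed_sphere.measurableSet
    simp only [weightMeasure, iteratedDeriv_zero]
    rw [he.memLp_map_measure_iff]
    have hc := continuous_restrict_circle f
    obtain ⟨C, hC⟩ := isCompact_univ.exists_bound_of_continuousOn hc.continuousOn
    exact MemLp.of_bound hc.aestronglyMeasurable C (Eventually.of_forall fun ζ => hC ζ trivial)
  | succ n =>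
    have hac : weightMeasure μ (n + 1) ≪ volume.restrict (Metric.ball 0 1) :=
      withDensity_absolutelyContinuous _ _
    obtain ⟨C, hC⟩ := exists_bound_iteratedDeriv f (n + 1)
    refine MemLp.of_bound (((continuousOn_iteratedDeriv f (n + 1)).aestronglyMeasurable
      Metric.isOpen_ball.measurableSet).mono_ac hac) C (hac.ae_le ?_)
    filter_upwards [ae_restrict_mem Metric.isOpen_ball.measurableSet] with z hz using hC z hz

/-- The limit defining the Dirichlet integral exists, and is the integral over the whole disc. -/
lemma tendsto_dirichletIntegral (μ : FiniteMeasure UnitCircle) (n : ℕ) (f : DA) :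
    Tendsto (fun r : ℝ => 1 / ((n + 1).factorial * n.factorial * Real.pi) *
        ∫ z in Metric.ball (0 : ℂ) r, ‖iteratedDeriv (n + 1) (f : ℂ → ℂ) z‖ ^ 2 *
          poissonExtension μ z * (1 - ‖z‖ ^ 2) ^ n) (𝓝[<] (1 : ℝ))
      (𝓝 (∫ z, ‖iteratedDeriv (n + 1) (f : ℂ → ℂ) z‖ ^ 2 ∂(weightMeasure μ (n + 1)))) := by
  have hmeas := measurable_weight μ n
  have h1 : ∀ g : ℂ → ℝ, ∀ s : Set ℂ, MeasurableSet s → s ⊆ Metric.ball 0 1 →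
      ∫ z in s, g z ∂(weightMeasure μ (n + 1)) =
        ∫ z in s, (1 / ((n + 1).factorial * n.factorial * Real.pi) *
        (poissonExtension μ z * (1 - ‖z‖ ^ 2) ^ n)) * g z := by
    intro g s hs hsub
    rw [weightMeasure, restrict_withDensity hs, Measure.restrict_restrict hs,
      Set.inter_eq_self_of_subset_left hsub,
      integral_withDensity_eq_integral_toReal_smul hmeas.ennreal_ofReal (by simp)]
    refine setIntegral_congr_fun hs fun z hz => ?_
    simp only [smul_eq_mul]
    rw [ENNReal.toReal_ofReal (weight_nonneg μ n (hsub hz))]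
  have hint : Integrable (fun z => ‖iteratedDeriv (n + 1) (f : ℂ → ℂ) z‖ ^ 2)
      (weightMeasure μ (n + 1)) := (memLp_iteratedDeriv μ (n + 1) f).integrable_norm_pow (by simp)
  have hcov : AECover (weightMeasure μ (n + 1)) (𝓝[<] (1 : ℝ))
      (fun r => Metric.ball (0 : ℂ) r) := by
    refine ⟨?_, fun r => Metric.isOpen_ball.measurableSet⟩
    have hac : weightMeasure μ (n + 1) ≪ volume.restrict (Metric.ball 0 1) :=
      withDensity_absolutelyContinuous _ _
    refine hac.ae_le ?_
    filter_upwards [ae_restrict_mem Metric.isOpen_ball.measurableSet] with z hz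
    have hz' : ‖z‖ < 1 := by simpa using hz
    filter_upwards [Ioo_mem_nhdsLT hz'] with r hr
    simpa using hr.1
  refine (hcov.integral_tendsto_of_countably_generated hint).congr' ?_
  filter_upwards [self_mem_nhdsWithin] with r hr
  rw [h1 _ _ Metric.isOpen_ball.measurableSet (Metric.ball_subset_ball (le_of_lt hr)),
    ← integral_const_mul]
  congr 1
  ext z
  ring

lemma dirichletIntegral_eq (μ : FiniteMeasure UnitCircle) (n : ℕ) (f : DA) :
    dirichletIntegral μ n f =
      ∫ z, ‖iteratedDeriv n (f : ℂ → ℂ) z‖ ^ 2 ∂(weightMeasure μ n) := by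
  cases n with
  | zero =>
    have he : MeasurableEmbedding (fun ζ : UnitCircle => (ζ : ℂ)) :=
      MeasurableEmbedding.subtype_coe Metric.isClosed_sphere.measurableSet
    simp only [dirichletIntegral, weightMeasure, iteratedDeriv_zero]
    rw [he.integral_map]
  | succ n => exact (tendsto_dirichletIntegral μ n f).limUnder_eq

/-! ### The model space and the model operator -/

/-- The space `𝒟ₐ`, equipped below with the seminorm `‖·‖_μ`. -/
def PreSpace {m : ℕ} (_μ : Fin m → FiniteMeasure UnitCircle) : Type := DA

variable {m : ℕ} (μ : Fin m → FiniteMeasure UnitCircle)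

instance : AddCommGroup (PreSpace μ) := inferInstanceAs (AddCommGroup DA)

instance : Module ℂ (PreSpace μ) := inferInstanceAs (Module ℂ DA)

/-- The identity map from `𝒟ₐ` to the copy of it that carries the seminorm `‖·‖_μ`. -/
def toPreSpace : DA ≃ₗ[ℂ] PreSpace μ := LinearEquiv.refl ℂ DA

/-- The semi-inner product that polarizes `‖·‖²_μ`. -/
def form (f g : DA) : ℂ :=
  ∑ n : Fin m, ∫ z, conj (iteratedDeriv n (f : ℂ → ℂ) z) * iteratedDeriv n (g : ℂ → ℂ) z
    ∂(weightMeasure (μ n) n)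

lemma integrable_form (ν : FiniteMeasure UnitCircle) (n : ℕ) (f g : DA) :
    Integrable (fun z => conj (iteratedDeriv n (f : ℂ → ℂ) z) * iteratedDeriv n (g : ℂ → ℂ) z)
      (weightMeasure ν n) :=
  MemLp.integrable_mul (p := 2) (q := 2) (memLp_iteratedDeriv ν n f).star
    (memLp_iteratedDeriv ν n g)

/-- Equalities between derivatives in the open disc hold almost everywhere. -/
lemma ae_weightMeasure (ν : FiniteMeasure UnitCircle) (n : ℕ) {p : ℂ → Prop}
    (h0 : n = 0 → ∀ z, p z) (h : ∀ z ∈ Metric.ball (0 : ℂ) 1, p z) :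
    ∀ᵐ z ∂(weightMeasure ν n), p z := by
  cases n with
  | zero => exact Eventually.of_forall (h0 rfl)
  | succ n =>
    have hac : weightMeasure ν (n + 1) ≪ volume.restrict (Metric.ball 0 1) :=
      withDensity_absolutelyContinuous _ _
    refine hac.ae_le ?_
    filter_upwards [ae_restrict_mem Metric.isOpen_ball.measurableSet] with z hz using h z hz

lemma contDiffAt_of_mem (f : DA) (n : ℕ) {z : ℂ} (hz : z ∈ Metric.ball (0 : ℂ) 1) :
    ContDiffAt ℂ n (f : ℂ → ℂ) z :=
  (f.2.1.analyticAt (Metric.isOpen_ball.mem_nhds hz)).contDiffAt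

lemma form_self (f : DA) : form μ f f = (normSq μ f : ℂ) := by
  simp only [form, normSq, dirichletIntegral_eq, Complex.ofReal_sum]
  refine Finset.sum_congr rfl fun n _ => ?_
  rw [← integral_complex_ofReal]
  congr 1
  ext z
  rw [mul_comm, Complex.mul_conj']
  push_cast
  rfl

lemma normSq_nonneg (f : DA) : 0 ≤ normSq μ f := by
  simp only [normSq, dirichletIntegral_eq]
  exact Finset.sum_nonneg fun n _ => integral_nonneg fun z => by positivity

lemma form_symm (f g : DA) : conj (form μ g f) = form μ f g := by
  simp only [form, map_sum, ← integral_conj]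
  refine Finset.sum_congr rfl fun n _ => integral_congr_ae (Eventually.of_forall fun z => ?_)
  simp [mul_comm]

lemma form_add_left (f g h : DA) : form μ (f + g) h = form μ f h + form μ g h := by
  simp only [form, ← Finset.sum_add_distrib]
  refine Finset.sum_congr rfl fun n _ => ?_
  rw [← integral_add (integrable_form _ _ _ _) (integrable_form _ _ _ _)]
  refine integral_congr_ae (ae_weightMeasure _ _ ?_ ?_)
  · intro hn z
    simp [hn, add_mul]
  · intro z hz
    have : iteratedDeriv n ((f + g : DA) : ℂ → ℂ) z = iteratedDeriv n (f : ℂ → ℂ) z +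
        iteratedDeriv n (g : ℂ → ℂ) z :=
      iteratedDeriv_add (contDiffAt_of_mem f n hz) (contDiffAt_of_mem g n hz)
    simp only [this, map_add, add_mul]

lemma form_smul_left (f g : DA) (c : ℂ) : form μ (c • f) g = conj c * form μ f g := by
  simp only [form, Finset.mul_sum]
  refine Finset.sum_congr rfl fun n _ => ?_
  rw [← integral_const_mul]
  refine integral_congr_ae (Eventually.of_forall fun z => ?_)
  have : iteratedDeriv n ((c • f : DA) : ℂ → ℂ) z = c * iteratedDeriv n (f : ℂ → ℂ) z :=
    iteratedDeriv_const_smul_field c _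
  simp only [this, map_mul, mul_assoc]

/-- The semi-inner product of `𝒟ₐ` whose quadratic form is `‖·‖²_μ`. -/
@[reducible]
def preCore : PreInnerProductSpace.Core ℂ (PreSpace μ) where
  inner f g := form μ ((toPreSpace μ).symm f) ((toPreSpace μ).symm g)
  conj_inner_symm f g := form_symm μ _ _
  re_inner_nonneg f := by
    rw [form_self]
    simpa using normSq_nonneg μ _
  add_left f g h := by rw [map_add, form_add_left]
  smul_left f g c := by rw [map_smul, form_smul_left]

instance : SeminormedAddCommGroup (PreSpace μ) :=
  @InnerProductSpace.Core.toSeminormedAddCommGroup ℂ (PreSpace μ) _ _ _ (preCore μ)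

instance : InnerProductSpace ℂ (PreSpace μ) := InnerProductSpace.ofCore (preCore μ)

lemma norm_toPreSpace_sq (f : DA) : ‖toPreSpace μ f‖ ^ 2 = normSq μ f := by
  rw [← inner_self_eq_norm_sq (𝕜 := ℂ)]
  exact congrArg Complex.re (form_self μ f)

/-- The Hilbert space `𝒟²_μ`: the completion of `𝒟ₐ / ker ‖·‖_μ` with respect to `‖·‖_μ`. (The
completion of a seminormed space is Hausdorff, so that it contains the quotient by the kernel.) -/
abbrev ModelSpace : Type := UniformSpace.Completion (PreSpace μ)

variable {μ}

lemma norm_mulZ_le (h : Allowable μ) (f : PreSpace μ) :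
    ‖toPreSpace μ (mulZ ((toPreSpace μ).symm f))‖ ≤ h.choose * ‖f‖ := by
  obtain ⟨f, rfl⟩ := (toPreSpace μ).surjective f
  obtain ⟨hC, hb⟩ := h.choose_spec
  refine (sq_le_sq₀ (norm_nonneg _) (by positivity)).1 ?_
  rw [mul_pow, norm_toPreSpace_sq, norm_toPreSpace_sq, LinearEquiv.symm_apply_apply]
  exact (hb f).2

/-- The operator `M_z` on `𝒟ₐ`, which is bounded for `‖·‖_μ` if the tuple is allowable. -/
def preOperator (h : Allowable μ) : PreSpace μ →L[ℂ] PreSpace μ :=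
  LinearMap.mkContinuous ((toPreSpace μ).toLinearMap ∘ₗ mulZ ∘ₗ (toPreSpace μ).symm.toLinearMap)
    h.choose (norm_mulZ_le h)

/-- The operator `M_μ` of an allowable tuple: the extension of `M_z` to a bounded linear operator on
`𝒟²_μ`. -/
def modelOperator (h : Allowable μ) : ModelSpace μ →L[ℂ] ModelSpace μ :=
  (preOperator h).completion

lemma modelOperator_coe (h : Allowable μ) (f : DA) :
    modelOperator h (toPreSpace μ f : ModelSpace μ) = (toPreSpace μ (mulZ f) : ModelSpace μ) :=
  (preOperator h).completion_apply_coe (toPreSpace μ f)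

/-! ### Higher order isometries -/

/-- `β_n(T) = ∑_{j ≤ n} (-1)ⁿ⁻ʲ (n choose j) T*ʲ Tʲ`. -/
def beta {H : Type*} [NormedAddCommGroup H] [InnerProductSpace ℂ H] [CompleteSpace H]
    (n : ℕ) (T : H →L[ℂ] H) : H →L[ℂ] H :=
  ∑ j ∈ Finset.range (n + 1),
    ((-1 : ℂ) ^ (n - j) * (n.choose j : ℂ)) • (ContinuousLinearMap.adjoint T ^ j * T ^ j)

/-- A bounded operator `T` is an `m`-isometry if `β_m(T) = 0`. -/
def IsMIsometry {H : Type*} [NormedAddCommGroup H] [InnerProductSpace ℂ H] [CompleteSpace H]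
    (m : ℕ) (T : H →L[ℂ] H) : Prop :=
  beta m T = 0

end

end DirichletModel

open DirichletModel

/-!
For `f ∈ 𝒟ₐ` and a point `ζ` of the circle write `f = f(ζ) + (z - ζ) g` with `g = ∑ gₖ zᵏ`. The
proof rests on the local Douglas formula (`lintegral_poissonKernel_eq`): the Dirichlet integral of
order `n ≥ 1` whose weight is the Poisson kernel at `ζ` equals `∑ₖ (k choose n - 1) |gₖ|²`. Indeed
the kernel is `(1 - |z|²) / |1 - ζ̄ z|²`, so the integral is the weighted Bergman norm of `f⁽ⁿ⁾ /
(1 - ζ̄ z)`, which `lintegral_bergman` expresses through Taylor coefficients. These coefficients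
are combinations of consecutive coefficients of `g⁽ⁿ⁻¹⁾ / (1 - ζ̄ z)`, and the resulting sum
telescopes (`sum_geomConv_add`); the boundary term vanishes in the limit because the Taylor
coefficients of `f` decay rapidly. By Tonelli, `𝒟_{μ,n}(f)` is the `μ`-integral of the local
expressions (`ofReal_dirichletIntegral`).

Multiplication by `z` turns `gₖ` into `gₖ₋₁`, where `g₋₁ = f(ζ)`, so Pascal's rule gives
`𝒟_{μ,n+1}(z f) = 𝒟_{μ,n+1}(f) + 𝒟_{μ,n}(f)`, while `𝒟_{μ,0}(z f) = 𝒟_{μ,0}(f)`. Hence the norm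
expands, and every `𝒟_{μ,n}(zʲ f)` with `n < m` is a polynomial in `j` of degree less than `m`, so
its `m`-th difference vanishes; that is the `m`-isometry identity on a dense subspace.

For the boundedness of `M_z` it remains to estimate `𝒟_{μₙ₊₁,n}(f)` by `‖f‖²_μ`. Since `(k choose
n - 1) ≤ n (k choose n)` for `k ≥ n`, only the term of `gₙ₋₁` in `𝒟_{μ,n}(f)` is not dominated by
its counterpart in `𝒟_{μ,n+1}(f)`, and `gₙ₋₁ = f̂(n) + ζ gₙ`; so `𝒟_{μ,n}(f)` is dominated by
`|f̂(n)|² + 𝒟_{μ,n+1}(f)` (`dirichletIntegral_le`). Finally `|f̂(n)|²` is dominated by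
`𝒟_{μ₀,0}(f)`, by applying the hypothesis on `f̂(0)` to iterated backward shifts of `f`
(`exists_bound_taylorCoeff`).
-/

/-! ### Tails of a sequence of coefficients -/

/-- The tail `∑ᵢ a_{k+i} ζⁱ`. If `f = ∑ aₖ zᵏ` converges absolutely on the closed disc and `|ζ| =
1`, then `coeffTail a ζ 0 = f(ζ)`, and `coeffTail a ζ (k + 1)` is the `k`-th Taylor coefficient of
the difference quotient `(f(z) - f(ζ)) / (z - ζ)`. -/
noncomputable def coeffTail (a : ℕ → ℂ) (ζ : ℂ) (k : ℕ) : ℂ := ∑' i, a (k + i) * ζ ^ i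

/-- Rapid decay of a sequence: it is absolutely summable against every polynomial weight. -/
def RapidDecay (a : ℕ → ℂ) : Prop := ∀ p : ℕ, Summable fun k : ℕ => ((k : ℝ) + 1) ^ p * ‖a k‖

lemma RapidDecay.summable_norm {a : ℕ → ℂ} (ha : RapidDecay a) : Summable fun k => ‖a k‖ := by
  simpa using ha 0

lemma summable_coeffTail {a : ℕ → ℂ} (ha : Summable fun k => ‖a k‖) {ζ : ℂ} (hζ : ‖ζ‖ = 1)
    (k : ℕ) : Summable fun i => ‖a (k + i) * ζ ^ i‖ := by
  simp only [norm_mul, norm_pow, hζ, one_pow, mul_one]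
  exact ha.comp_injective (add_right_injective k)

lemma coeffTail_eq_add {a : ℕ → ℂ} (ha : Summable fun k => ‖a k‖) {ζ : ℂ} (hζ : ‖ζ‖ = 1)
    (k : ℕ) : coeffTail a ζ k = a k + ζ * coeffTail a ζ (k + 1) := by
  rw [coeffTail, (summable_coeffTail ha hζ k).of_norm.tsum_eq_zero_add, coeffTail, ← tsum_mul_left]
  simp only [add_zero, pow_zero, mul_one]
  congr 1
  refine tsum_congr fun i => ?_
  rw [show k + (i + 1) = k + 1 + i by ring, pow_succ]
  ring

lemma norm_coeffTail_le {a : ℕ → ℂ} (ha : RapidDecay a) {ζ : ℂ} (hζ : ‖ζ‖ = 1) (p k : ℕ) :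
    ((k : ℝ) + 1) ^ p * ‖coeffTail a ζ k‖ ≤ ∑' i : ℕ, ((i : ℝ) + 1) ^ p * ‖a i‖ := by
  have hs : Summable fun i : ℕ => (((k + i : ℕ) : ℝ) + 1) ^ p * ‖a (k + i)‖ :=
    (ha p).comp_injective (add_right_injective k)
  have h1 : ‖coeffTail a ζ k‖ ≤ ∑' i, ‖a (k + i)‖ := by
    refine (norm_tsum_le_tsum_norm (summable_coeffTail ha.summable_norm hζ k)).trans (le_of_eq ?_)
    simp [hζ]
  calc ((k : ℝ) + 1) ^ p * ‖coeffTail a ζ k‖ ≤ ((k : ℝ) + 1) ^ p * ∑' i, ‖a (k + i)‖ := by gcongr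
    _ = ∑' i, ((k : ℝ) + 1) ^ p * ‖a (k + i)‖ := tsum_mul_left.symm
    _ ≤ ∑' i : ℕ, (((k + i : ℕ) : ℝ) + 1) ^ p * ‖a (k + i)‖ := by
      refine Summable.tsum_le_tsum (fun i => ?_)
        ((ha.summable_norm.comp_injective (add_right_injective k)).mul_left _) hs
      push_cast
      gcongr
      linarith [(Nat.cast_nonneg i : (0 : ℝ) ≤ i)]
    _ ≤ ∑' i : ℕ, ((i : ℝ) + 1) ^ p * ‖a i‖ :=
      tsum_comp_le_tsum_of_inj (ha p) (fun i => by positivity) (add_right_injective k)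

/-- The tails of a rapidly decreasing sequence are rapidly decreasing. -/
lemma rapidDecay_coeffTail {a : ℕ → ℂ} (ha : RapidDecay a) {ζ : ℂ} (hζ : ‖ζ‖ = 1) :
    RapidDecay fun k => coeffTail a ζ (k + 1) := by
  intro p
  have h2 : Summable fun k : ℕ => 1 / ((k : ℝ) + 1) ^ 2 := by
    have := (summable_nat_add_iff 1).2 (Real.summable_one_div_nat_pow.2 (one_lt_two))
    simpa using this
  refine Summable.of_nonneg_of_le (fun k => by positivity) (fun k => ?_)
    (h2.mul_left (∑' i : ℕ, ((i : ℝ) + 1) ^ (p + 2) * ‖a i‖))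
  rw [mul_one_div, le_div_iff₀ (by positivity)]
  refine le_trans ?_ (norm_coeffTail_le ha hζ (p + 2) (k + 1))
  rw [mul_right_comm, ← pow_add]
  push_cast
  gcongr
  linarith

/-! ### The coefficients of `f⁽ⁿ⁾(z) / (1 - ζ̄ z)` -/

/-- The `k`-th Taylor coefficient of the `n`-th derivative of `∑ aₖ zᵏ`. -/
def derivCoeff (n : ℕ) (a : ℕ → ℂ) (k : ℕ) : ℂ := ((k + n).descFactorial n : ℂ) * a (k + n)

/-- The `k`-th Taylor coefficient of `(∑ bⱼ zʲ) / (1 - c z)`. -/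
def geomConv (c : ℂ) (b : ℕ → ℂ) (k : ℕ) : ℂ := ∑ j ∈ Finset.range (k + 1), b j * c ^ (k - j)

lemma geomConv_zero (c : ℂ) (b : ℕ → ℂ) : geomConv c b 0 = b 0 := by simp [geomConv]

lemma geomConv_succ (c : ℂ) (b : ℕ → ℂ) (k : ℕ) :
    geomConv c b (k + 1) = c * geomConv c b k + b (k + 1) := by
  rw [geomConv, Finset.sum_range_succ, geomConv, Finset.mul_sum]
  congr 1
  · refine Finset.sum_congr rfl fun j hj => ?_
    rw [show k + 1 - j = k - j + 1 by have := Finset.mem_range.1 hj; omega, pow_succ]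
    ring
  · simp

lemma RapidDecay.summable_derivCoeff {a : ℕ → ℂ} (ha : RapidDecay a) (n : ℕ) :
    Summable fun k => ‖derivCoeff n a k‖ := by
  refine Summable.of_nonneg_of_le (fun k => norm_nonneg _) (fun k => ?_)
    ((ha n).comp_injective (add_left_injective n))
  have h : (((k + n).descFactorial n : ℕ) : ℝ) ≤ ((k + n : ℕ) : ℝ) ^ n := by
    exact_mod_cast Nat.descFactorial_le_pow _ _
  simp only [derivCoeff, norm_mul, Complex.norm_natCast, Function.comp]
  gcongr
  exact h.trans (by gcongr; linarith)

lemma norm_geomConv_le {b : ℕ → ℂ} (hb : Summable fun k => ‖b k‖) {c : ℂ} (hc : ‖c‖ = 1)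
    (k : ℕ) : ‖geomConv c b k‖ ≤ ∑' j, ‖b j‖ := by
  refine (norm_sum_le _ _).trans ?_
  simp only [norm_mul, norm_pow, hc, one_pow, mul_one]
  exact hb.sum_le_tsum _ fun j _ => norm_nonneg _

lemma hasSum_geomConv {b : ℕ → ℂ} (hb : Summable fun k => ‖b k‖) {c : ℂ} (hc : ‖c‖ = 1) {z : ℂ}
    (hz : ‖z‖ < 1) :
    HasSum (fun k => geomConv c b k * z ^ k) ((∑' k, b k * z ^ k) / (1 - c * z)) := by
  have hcz : ‖c * z‖ < 1 := by rwa [norm_mul, hc, one_mul]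
  have h1 : Summable fun k => ‖b k * z ^ k‖ := by
    refine Summable.of_nonneg_of_le (fun k => norm_nonneg _) (fun k => ?_) hb
    rw [norm_mul, norm_pow]
    exact mul_le_of_le_one_right (norm_nonneg _) (pow_le_one₀ (norm_nonneg _) hz.le)
  have h2 : Summable fun k => ‖(c * z) ^ k‖ := by
    simpa using summable_geometric_of_lt_one (norm_nonneg _) hcz
  have h3 := hasSum_sum_range_mul_of_summable_norm h1 h2
  rw [tsum_geometric_of_norm_lt_one hcz, ← div_eq_mul_inv] at h3
  have h4 : (fun k => geomConv c b k * z ^ k) = fun k =>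
      ∑ j ∈ Finset.range (k + 1), b j * z ^ j * (c * z) ^ (k - j) := by
    funext k
    rw [geomConv, Finset.sum_mul]
    refine Finset.sum_congr rfl fun j hj => ?_
    rw [mul_pow, mul_mul_mul_comm, ← pow_add,
      show j + (k - j) = k by have := Finset.mem_range.1 hj; omega]
  rwa [h4]

/-! ### The telescoping identity -/

/-- Coefficientwise form of `f⁽ⁿ⁺¹⁾ / (1 - ζ̄ z) = (n + 1) g⁽ⁿ⁾ / (1 - ζ̄ z) - ζ g⁽ⁿ⁺¹⁾`, where
`f = f(ζ) + (z - ζ) g`. -/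
lemma geomConv_derivCoeff_succ {a g : ℕ → ℂ} {ζ : ℂ} (hζ : ‖ζ‖ = 1)
    (hg : ∀ k, a (k + 1) = g k - ζ * g (k + 1)) (n k : ℕ) :
    geomConv (conj ζ) (derivCoeff (n + 1) a) k =
      (n + 1) * geomConv (conj ζ) (derivCoeff n g) k - (k + 1) * ζ * derivCoeff n g (k + 1) := by
  have hcζ : conj ζ * ζ = 1 := by rw [Complex.conj_mul', hζ]; simp
  have key : ∀ k, derivCoeff (n + 1) a k =
      (k + n + 1) * derivCoeff n g k - (k + 1) * ζ * derivCoeff n g (k + 1) := by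
    intro k
    have e1 : (k + (n + 1)).descFactorial (n + 1) = (k + n + 1) * (k + n).descFactorial n :=
      Nat.succ_descFactorial_succ _ _
    have e2 : (k + (n + 1)).descFactorial (n + 1) = (k + 1) * (k + 1 + n).descFactorial n := by
      rw [Nat.descFactorial_succ, show k + (n + 1) - n = k + 1 by omega,
        show k + (n + 1) = k + 1 + n by ring]
    have e1' : ((k + (n + 1)).descFactorial (n + 1) : ℂ) =
        (k + n + 1) * (k + n).descFactorial n := by exact_mod_cast e1
    have e2' : ((k + (n + 1)).descFactorial (n + 1) : ℂ) =
        (k + 1) * (k + 1 + n).descFactorial n := by exact_mod_cast e2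
    rw [derivCoeff, show k + (n + 1) = (k + n) + 1 by ring, hg, mul_sub,
      show k + n + 1 = k + (n + 1) by ring]
    nth_rewrite 1 [e1']
    rw [e2', derivCoeff, derivCoeff, show k + (n + 1) = k + 1 + n by ring]
    ring
  induction k with
  | zero =>
    rw [geomConv_zero, geomConv_zero, key]
    push_cast
    ring
  | succ k ih =>
    rw [geomConv_succ, geomConv_succ, key, ih]
    push_cast
    linear_combination (-(k + 1) * derivCoeff n g (k + 1)) * hcζ

/-- Partial sums of both sides of the local Douglas formula. With `Sₖ` the coefficients of `g⁽ⁿ⁾ /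
(1 - ζ̄ z)`, the `k`-th coefficient of `f⁽ⁿ⁺¹⁾ / (1 - ζ̄ z)` is `(k + n + 2) Sₖ - (k + 1) ζ Sₖ₊₁`,
and the corresponding terms of the two sums differ by an increment of `(n + 1) k! / (k + n + 1)!
|Sₖ|²`. -/
lemma sum_geomConv_add {a g : ℕ → ℂ} {ζ : ℂ} (hζ : ‖ζ‖ = 1)
    (hg : ∀ k, a (k + 1) = g k - ζ * g (k + 1)) (n K : ℕ) :
    ∑ k ∈ Finset.range K, (k.factorial : ℝ) / (k + n + 2).factorial *
        ‖geomConv (conj ζ) (derivCoeff (n + 1) a) k‖ ^ 2 +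
      (n + 1) * ((K.factorial : ℝ) / (K + n + 1).factorial *
        ‖geomConv (conj ζ) (derivCoeff n g) K‖ ^ 2) =
    ∑ k ∈ Finset.range (K + 1), (k.factorial : ℝ) / (k + n).factorial * ‖derivCoeff n g k‖ ^ 2 := by
  induction K with
  | zero =>
    simp only [Finset.range_zero, Finset.sum_empty, zero_add, Finset.sum_range_one,
      geomConv_zero, Nat.factorial_succ]
    push_cast
    field_simp
  | succ K ih =>
    rw [Finset.sum_range_succ _ (K + 1), ← ih, Finset.sum_range_succ]
    set A := geomConv (conj ζ) (derivCoeff n g) K with hA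
    set B := ζ * geomConv (conj ζ) (derivCoeff n g) (K + 1) with hB
    have hcζ : ζ * conj ζ = 1 := by rw [Complex.mul_conj', hζ]; simp
    have hGB : ζ * derivCoeff n g (K + 1) = B - A := by
      rw [hB, geomConv_succ, ← hA]
      linear_combination -A * hcζ
    have h1 : ‖geomConv (conj ζ) (derivCoeff n g) (K + 1)‖ = ‖B‖ := by
      rw [hB, norm_mul, hζ, one_mul]
    have h2 : ‖derivCoeff n g (K + 1)‖ = ‖B - A‖ := by rw [← hGB, norm_mul, hζ, one_mul]
    have h3 : geomConv (conj ζ) (derivCoeff (n + 1) a) K = (K + n + 2) * A - (K + 1) * B := by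
      rw [geomConv_derivCoeff_succ hζ hg, ← hA, mul_assoc, hGB]
      ring
    rw [h1, h2, h3, show K + 1 + n + 1 = (K + n + 1) + 1 by ring,
      show K + 1 + n = K + n + 1 by ring, show K + n + 2 = (K + n + 1) + 1 by ring,
      Nat.factorial_succ K, Nat.factorial_succ (K + n + 1)]
    simp only [Complex.sq_norm, Complex.normSq_apply]
    simp
    field_simp
    ring

/-- Local Douglas formula on the level of coefficients: the weighted Bergman norm of
`f⁽ⁿ⁺¹⁾ / (1 - ζ̄ z)` is a weighted `ℓ²`-norm of the coefficients of the difference quotient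
`(f(z) - f(ζ)) / (z - ζ)`. -/
lemma tsum_geomConv_eq {a : ℕ → ℂ} (ha : RapidDecay a) {ζ : ℂ} (hζ : ‖ζ‖ = 1) (n : ℕ) :
    ∑' k, ENNReal.ofReal ((k.factorial : ℝ) / (k + n + 2).factorial *
        ‖geomConv (conj ζ) (derivCoeff (n + 1) a) k‖ ^ 2) =
      ENNReal.ofReal n.factorial *
        ∑' k : ℕ, ENNReal.ofReal ((k.choose n : ℝ) * ‖coeffTail a ζ (k + 1)‖ ^ 2) := by
  set g : ℕ → ℂ := fun k => coeffTail a ζ (k + 1) with hgdef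
  have hg : ∀ k, a (k + 1) = g k - ζ * g (k + 1) := fun k => by
    rw [hgdef]
    simp only
    rw [coeffTail_eq_add ha.summable_norm hζ (k + 1)]
    ring
  have hdecay : RapidDecay g := rapidDecay_coeffTail ha hζ
  have hcc : ‖conj ζ‖ = 1 := by simpa using hζ
  -- the boundary term of the telescoping sum vanishes in the limit
  have hu : Tendsto (fun K : ℕ => ((n : ℝ) + 1) * ((K.factorial : ℝ) / (K + n + 1).factorial *
      ‖geomConv (conj ζ) (derivCoeff n g) K‖ ^ 2)) atTop (𝓝 0) := by
    set M := ∑' j, ‖derivCoeff n g j‖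
    have hlim : Tendsto (fun K : ℕ => ((n : ℝ) + 1) * (1 / ((K : ℝ) + 1) * M ^ 2)) atTop (𝓝 0) := by
      simpa using
        (tendsto_one_div_add_atTop_nhds_zero_nat.mul_const (M ^ 2)).const_mul ((n : ℝ) + 1)
    refine squeeze_zero (fun K => by positivity) (fun K => ?_) hlim
    have h1 := norm_geomConv_le (hdecay.summable_derivCoeff n) hcc K
    have h2 : (K.factorial : ℝ) / (K + n + 1).factorial ≤ 1 / ((K : ℝ) + 1) := by
      rw [div_le_div_iff₀ (by positivity) (by positivity)]
      have h3 : (K + 1).factorial ≤ (K + n + 1).factorial := Nat.factorial_le (by omega)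
      rw [Nat.factorial_succ] at h3
      have h4 : ((K : ℝ) + 1) * K.factorial ≤ (K + n + 1).factorial := by exact_mod_cast h3
      linarith
    gcongr
  have hl := (ENNReal.tendsto_nat_tsum fun k => ENNReal.ofReal ((k.factorial : ℝ) /
    (k + n + 2).factorial * ‖geomConv (conj ζ) (derivCoeff (n + 1) a) k‖ ^ 2)).add
      (ENNReal.tendsto_ofReal hu)
  have hr := (ENNReal.tendsto_nat_tsum fun k => ENNReal.ofReal ((k.factorial : ℝ) /
    (k + n).factorial * ‖derivCoeff n g k‖ ^ 2)).comp (tendsto_add_atTop_nat 1)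
  have heq := tendsto_nhds_unique (hl.congr fun K => ?_) hr
  · rw [ENNReal.ofReal_zero, add_zero] at heq
    rw [heq, ← ENNReal.tsum_mul_left]
    have hz : ∀ k ∉ Set.range (fun j : ℕ => j + n), ENNReal.ofReal n.factorial *
        ENNReal.ofReal ((k.choose n : ℝ) * ‖g k‖ ^ 2) = 0 := by
      intro k hk
      have : k < n := by
        by_contra h
        exact hk ⟨k - n, by simp; omega⟩
      simp [Nat.choose_eq_zero_of_lt this]
    rw [← (add_left_injective n).tsum_eq (f := fun k : ℕ => ENNReal.ofReal n.factorial *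
      ENNReal.ofReal ((k.choose n : ℝ) * ‖g k‖ ^ 2)) (fun k hk => by
        by_contra h
        exact hk (hz k h))]
    refine tsum_congr fun k => ?_
    rw [← ENNReal.ofReal_mul (by positivity)]
    congr 1
    have e1 : (k.factorial : ℝ) * (k + n).descFactorial n = (k + n).factorial := by
      have := Nat.factorial_mul_descFactorial (n := k + n) (k := n) (by omega)
      rw [Nat.add_sub_cancel] at this
      exact_mod_cast this
    have e2 : ((k + n).descFactorial n : ℝ) = n.factorial * (k + n).choose n := by
      exact_mod_cast Nat.descFactorial_eq_factorial_mul_choose (k + n) n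
    have e3 : ((k + n).factorial : ℝ) ≠ 0 := by positivity
    rw [derivCoeff, norm_mul, Complex.norm_natCast, mul_pow, ← mul_assoc, ← mul_assoc, ← e2]
    congr 1
    rw [div_mul_eq_mul_div, div_eq_iff e3, ← e1]
    ring
  · simp only [Function.comp]
    rw [← ENNReal.ofReal_sum_of_nonneg (fun k _ => by positivity),
      ← ENNReal.ofReal_sum_of_nonneg (fun k _ => by positivity),
      ← ENNReal.ofReal_add (Finset.sum_nonneg fun k _ => by positivity) (by positivity),
      sum_geomConv_add hζ hg]

/-! ### Parseval's identity and weighted Bergman norms -/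

lemma integral_exp_int_mul_I (n : ℤ) :
    ∫ θ in (-Real.pi)..Real.pi, Complex.exp (n * Complex.I * θ) =
      if n = 0 then 2 * (Real.pi : ℂ) else 0 := by
  split_ifs with h
  · simp [h]
    ring
  · have h1 : (n : ℂ) * Complex.I ≠ 0 := by simp [h]
    rw [integral_exp_mul_complex h1, div_eq_zero_iff]
    left
    rw [sub_eq_zero, Complex.exp_eq_exp_iff_exists_int]
    exact ⟨n, by push_cast; ring⟩

/-- The boundary function `θ ↦ ∑ cₖ e^{ikθ}` of a power series. -/
noncomputable def expSeries (c : ℕ → ℂ) (θ : ℝ) : ℂ :=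
  ∑' k : ℕ, c k * Complex.exp (k * Complex.I * θ)

lemma norm_exp_nat_mul_I (k : ℕ) (θ : ℝ) : ‖Complex.exp (k * Complex.I * θ)‖ = 1 := by
  rw [show (k : ℂ) * Complex.I * θ = ((k * θ : ℝ) : ℂ) * Complex.I by push_cast; ring,
    Complex.norm_exp_ofReal_mul_I]

lemma summable_expSeries {c : ℕ → ℂ} (hc : Summable fun k => ‖c k‖) (θ : ℝ) :
    Summable fun k : ℕ => ‖c k * Complex.exp (k * Complex.I * θ)‖ := by
  simpa only [norm_mul, norm_exp_nat_mul_I, mul_one] using hc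

lemma norm_expSeries_le {c : ℕ → ℂ} (hc : Summable fun k => ‖c k‖) (θ : ℝ) :
    ‖expSeries c θ‖ ≤ ∑' k, ‖c k‖ := by
  refine (norm_tsum_le_tsum_norm (summable_expSeries hc θ)).trans (le_of_eq ?_)
  simp only [norm_mul, norm_exp_nat_mul_I, mul_one]

lemma continuous_expSeries {c : ℕ → ℂ} (hc : Summable fun k => ‖c k‖) :
    Continuous (expSeries c) :=
  continuous_tsum (fun k => by fun_prop) hc fun k θ => by
    rw [norm_mul, norm_exp_nat_mul_I, mul_one]

lemma hasSum_integral_mul_expSeries {c : ℕ → ℂ} (hc : Summable fun k => ‖c k‖) {Φ : ℝ → ℂ}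
    (hΦ : Continuous Φ) {M : ℝ} (hM : ∀ θ, ‖Φ θ‖ ≤ M) :
    HasSum (fun k : ℕ => c k * ∫ θ in (-Real.pi)..Real.pi, Φ θ * Complex.exp (k * Complex.I * θ))
      (∫ θ in (-Real.pi)..Real.pi, Φ θ * expSeries c θ) := by
  have h := intervalIntegral.hasSum_integral_of_dominated_convergence (a := -Real.pi)
    (b := Real.pi) (μ := volume)
    (F := fun (k : ℕ) θ => c k * (Φ θ * Complex.exp (k * Complex.I * θ)))
    (f := fun θ => Φ θ * expSeries c θ) (fun k _ => ‖c k‖ * M)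
    (fun k => Continuous.aestronglyMeasurable (by fun_prop))
    (fun k => Eventually.of_forall fun θ _ => by
      rw [norm_mul, norm_mul, norm_exp_nat_mul_I, mul_one]
      exact mul_le_mul_of_nonneg_left (hM θ) (norm_nonneg _))
    (Eventually.of_forall fun θ _ => hc.mul_right M) (by simp)
    (Eventually.of_forall fun θ _ => by
      have := ((summable_expSeries hc θ).of_norm.hasSum).mul_left (Φ θ)
      refine this.congr_fun fun k => ?_
      ring)
  simpa only [intervalIntegral.integral_const_mul] using h

lemma integral_conj_exp_mul_expSeries {c : ℕ → ℂ} (hc : Summable fun k => ‖c k‖) (j : ℕ) :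
    ∫ θ in (-Real.pi)..Real.pi, conj (Complex.exp (j * Complex.I * θ)) * expSeries c θ =
      2 * Real.pi * c j := by
  have h := hasSum_integral_mul_expSeries hc
    (Φ := fun θ : ℝ => conj (Complex.exp (j * Complex.I * θ)))
    (Complex.continuous_conj.comp (by fun_prop)) (M := 1)
    (fun θ => by rw [RCLike.norm_conj, norm_exp_nat_mul_I])
  have h1 : ∀ k : ℕ, c k * ∫ θ in (-Real.pi)..Real.pi,
      conj (Complex.exp (j * Complex.I * θ)) * Complex.exp (k * Complex.I * θ) =
      if k = j then 2 * Real.pi * c j else 0 := by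
    intro k
    have h2 : ∀ θ : ℝ, conj (Complex.exp (j * Complex.I * θ)) * Complex.exp (k * Complex.I * θ) =
        Complex.exp (((k : ℤ) - j : ℤ) * Complex.I * θ) := by
      intro θ
      rw [← Complex.exp_conj, ← Complex.exp_add]
      congr 1
      simp
      ring
    simp only [h2, integral_exp_int_mul_I, sub_eq_zero, Nat.cast_inj]
    split_ifs with hk
    · rw [hk]; ring
    · simp
  simp only [h1] at h
  exact h.unique (hasSum_ite_eq j _)

/-- Parseval's identity. -/
lemma hasSum_integral_sq_expSeries {c : ℕ → ℂ} (hc : Summable fun k => ‖c k‖) :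
    HasSum (fun k => 2 * Real.pi * ‖c k‖ ^ 2)
      (∫ θ in (-Real.pi)..Real.pi, ‖expSeries c θ‖ ^ 2) := by
  have h := hasSum_integral_mul_expSeries hc (Φ := fun θ => conj (expSeries c θ))
    (Complex.continuous_conj.comp (continuous_expSeries hc))
    (fun θ => by rw [RCLike.norm_conj]; exact norm_expSeries_le hc θ)
  have h1 : ∀ k : ℕ, c k * ∫ θ in (-Real.pi)..Real.pi,
      conj (expSeries c θ) * Complex.exp (k * Complex.I * θ) =
      ((2 * Real.pi * ‖c k‖ ^ 2 : ℝ) : ℂ) := by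
    intro k
    have h2 := congrArg conj (integral_conj_exp_mul_expSeries hc k)
    simp only [intervalIntegral.integral_of_le (neg_le_self Real.pi_pos.le),
      ← integral_conj] at h2 ⊢
    simp only [map_mul, Complex.conj_conj, Complex.conj_ofReal, map_ofNat] at h2
    simp only [mul_comm (conj (expSeries c _)), h2]
    push_cast
    rw [← Complex.mul_conj']
    ring
  have h3 : ∫ θ in (-Real.pi)..Real.pi, conj (expSeries c θ) * expSeries c θ =
      ((∫ θ in (-Real.pi)..Real.pi, ‖expSeries c θ‖ ^ 2 : ℝ) : ℂ) := by
    rw [← intervalIntegral.integral_ofReal]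
    simp only [Complex.conj_mul']
    push_cast
    rfl
  simp only [h1, h3] at h
  exact Complex.hasSum_ofReal.1 h

lemma lintegral_sq_expSeries {c : ℕ → ℂ} (hc : Summable fun k => ‖c k‖) :
    ∫⁻ θ in Set.Ioo (-Real.pi) Real.pi, ENNReal.ofReal (‖expSeries c θ‖ ^ 2) =
      ∑' k, ENNReal.ofReal (2 * Real.pi * ‖c k‖ ^ 2) := by
  have hpi := Real.pi_pos
  have h := hasSum_integral_sq_expSeries hc
  rw [← ENNReal.ofReal_tsum_of_nonneg (fun k => by positivity) h.summable, h.tsum_eq,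
    intervalIntegral.integral_of_le (by linarith),
    integral_Ioc_eq_integral_Ioo, ofReal_integral_eq_lintegral_ofReal]
  · have := (continuous_expSeries hc).norm.pow 2
    exact (this.integrableOn_Icc (a := -Real.pi) (b := Real.pi)).mono_set Set.Ioo_subset_Icc_self
  · exact Eventually.of_forall fun θ => by positivity

lemma integral_pow_mul_one_sub_sq_pow (k n : ℕ) :
    ∫ r in (0 : ℝ)..1, r ^ (2 * k + 1) * (1 - r ^ 2) ^ n =
      (k.factorial : ℝ) * n.factorial / (2 * (k + n + 1).factorial) := by
  induction n generalizing k with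
  | zero =>
    simp only [pow_zero, mul_one, integral_pow, Nat.factorial_succ, Nat.factorial_zero, add_zero]
    push_cast
    have : (k.factorial : ℝ) ≠ 0 := by positivity
    field_simp
    norm_num
    ring
  | succ n ih =>
    -- integration by parts
    have h : ∀ r : ℝ, HasDerivAt (fun r : ℝ => r ^ (2 * k + 2) * (1 - r ^ 2) ^ (n + 1))
        ((2 * k + 2) * (r ^ (2 * k + 1) * (1 - r ^ 2) ^ (n + 1)) -
          2 * (n + 1) * (r ^ (2 * (k + 1) + 1) * (1 - r ^ 2) ^ n)) r := by
      intro r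
      have h1 := (hasDerivAt_pow (2 * k + 2) r).mul
        (((hasDerivAt_pow 2 r).const_sub 1).pow (n + 1))
      refine h1.congr_deriv ?_
      simp
      ring
    have h2 := intervalIntegral.integral_eq_sub_of_hasDerivAt (a := 0) (b := 1)
      (fun r _ => h r) (Continuous.intervalIntegrable (by fun_prop) _ _)
    rw [intervalIntegral.integral_sub (Continuous.intervalIntegrable (by fun_prop) _ _)
      (Continuous.intervalIntegrable (by fun_prop) _ _), intervalIntegral.integral_const_mul,
      intervalIntegral.integral_const_mul, ih] at h2
    have h3 : (∫ r in (0 : ℝ)..1, r ^ (2 * k + 1) * (1 - r ^ 2) ^ (n + 1)) * (2 * k + 2) =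
        2 * (n + 1) * (((k + 1).factorial : ℝ) * n.factorial /
          (2 * (k + 1 + n + 1).factorial)) := by
      simp at h2
      linarith
    have h4 : (2 * (k : ℝ) + 2) ≠ 0 := by positivity
    rw [← mul_left_inj' h4, h3, show k + 1 + n + 1 = k + (n + 1) + 1 by ring, Nat.factorial_succ k,
      Nat.factorial_succ n]
    push_cast
    field_simp

lemma lintegral_pow_mul_one_sub_sq_pow (k n : ℕ) :
    ∫⁻ r in Set.Ioo (0 : ℝ) 1, ENNReal.ofReal (r ^ (2 * k + 1) * (1 - r ^ 2) ^ n) =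
      ENNReal.ofReal ((k.factorial : ℝ) * n.factorial / (2 * (k + n + 1).factorial)) := by
  rw [← integral_pow_mul_one_sub_sq_pow, intervalIntegral.integral_of_le zero_le_one,
    integral_Ioc_eq_integral_Ioo, ofReal_integral_eq_lintegral_ofReal]
  · exact (Continuous.integrableOn_Icc (by fun_prop)).mono_set Set.Ioo_subset_Icc_self
  · filter_upwards [ae_restrict_mem measurableSet_Ioo] with r hr
    have : 0 ≤ 1 - r ^ 2 := by nlinarith [hr.1, hr.2]
    have := hr.1
    simp only [Pi.zero_apply]
    positivity

/-- Area integrals over the unit disc in polar coordinates. -/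
lemma lintegral_ball_eq_polar {φ : ℂ → ENNReal}
    (hφ : Measurable ((Metric.ball (0 : ℂ) 1).indicator φ)) :
    ∫⁻ z in Metric.ball (0 : ℂ) 1, φ z = ∫⁻ r in Set.Ioo (0 : ℝ) 1,
      ENNReal.ofReal r * ∫⁻ θ in Set.Ioo (-Real.pi) Real.pi,
        φ (r * Complex.exp (θ * Complex.I)) := by
  have hexp : ∀ p : ℝ × ℝ, Complex.polarCoord.symm p = p.1 * Complex.exp (p.2 * Complex.I) := by
    intro p
    rw [Complex.polarCoord_symm_apply, Complex.exp_mul_I]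
    simp
  have hm : Measurable fun p : ℝ × ℝ => (Metric.ball (0 : ℂ) 1).indicator φ
      (p.1 * Complex.exp (p.2 * Complex.I)) :=
    hφ.comp (by fun_prop : Continuous fun p : ℝ × ℝ =>
      (p.1 : ℂ) * Complex.exp (p.2 * Complex.I)).measurable
  rw [← lintegral_indicator Metric.isOpen_ball.measurableSet,
    ← Complex.lintegral_comp_polarCoord_symm]
  simp only [hexp, smul_eq_mul, polarCoord_target]
  rw [Measure.volume_eq_prod, setLIntegral_prod _ (by fun_prop),
    ← Set.Ioo_union_Ici_eq_Ioi (zero_lt_one (α := ℝ)),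
    lintegral_union measurableSet_Ici (Set.disjoint_left.2 fun x hx hx' => not_lt.2 hx' hx.2)]
  have hin : ∀ r : ℝ, 0 ≤ r → ∀ θ : ℝ, ‖(r : ℂ) * Complex.exp (θ * Complex.I)‖ = r := by
    intro r hr θ
    rw [norm_mul, Complex.norm_exp_ofReal_mul_I, mul_one, Complex.norm_of_nonneg hr]
  have h2 : ∫⁻ r in Set.Ici (1 : ℝ), ∫⁻ θ in Set.Ioo (-Real.pi) Real.pi, ENNReal.ofReal r *
      (Metric.ball (0 : ℂ) 1).indicator φ (r * Complex.exp (θ * Complex.I)) = 0 := by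
    rw [setLIntegral_congr_fun (g := fun _ => 0) measurableSet_Ici, lintegral_zero]
    intro r hr
    have hr' : (1 : ℝ) ≤ r := hr
    have : ∀ θ : ℝ, (Metric.ball (0 : ℂ) 1).indicator φ (r * Complex.exp (θ * Complex.I)) = 0 := by
      intro θ
      refine Set.indicator_of_notMem ?_ _
      rw [mem_ball_zero_iff, hin r (by linarith) θ]
      linarith
    simp [this]
  rw [h2, add_zero]
  refine setLIntegral_congr_fun measurableSet_Ioo fun r hr => ?_
  simp only
  rw [← lintegral_const_mul' _ _ ENNReal.ofReal_ne_top]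
  refine lintegral_congr fun θ => ?_
  rw [Set.indicator_of_mem]
  rw [mem_ball_zero_iff, hin r hr.1.le θ]
  exact hr.2

/-- The weighted Bergman norm of a power series in terms of its coefficients. -/
lemma lintegral_bergman {h : ℂ → ℂ} {c : ℕ → ℂ} {M : ℝ} (hM : ∀ k, ‖c k‖ ≤ M)
    (hcont : ContinuousOn h (Metric.ball 0 1))
    (hsum : ∀ z : ℂ, ‖z‖ < 1 → HasSum (fun k => c k * z ^ k) (h z)) (n : ℕ) :
    ∫⁻ z in Metric.ball (0 : ℂ) 1, ENNReal.ofReal (‖h z‖ ^ 2 * (1 - ‖z‖ ^ 2) ^ n) =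
      ∑' k, ENNReal.ofReal (Real.pi * (n.factorial *
        ((k.factorial : ℝ) / (k + n + 1).factorial * ‖c k‖ ^ 2))) := by
  have hpi := Real.pi_pos
  have hmeas : Measurable ((Metric.ball (0 : ℂ) 1).indicator fun z =>
      ENNReal.ofReal (‖h z‖ ^ 2 * (1 - ‖z‖ ^ 2) ^ n)) := by
    classical
    rw [← Set.piecewise_eq_indicator]
    refine ContinuousOn.measurable_piecewise ?_ continuousOn_const Metric.isOpen_ball.measurableSet
    refine ENNReal.continuous_ofReal.comp_continuousOn ?_
    exact (hcont.norm.pow 2).mul (by fun_prop)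
  rw [lintegral_ball_eq_polar hmeas]
  have hr : ∀ r ∈ Set.Ioo (0 : ℝ) 1, ENNReal.ofReal r * ∫⁻ θ in Set.Ioo (-Real.pi) Real.pi,
      ENNReal.ofReal (‖h (r * Complex.exp (θ * Complex.I))‖ ^ 2 *
        (1 - ‖(r : ℂ) * Complex.exp (θ * Complex.I)‖ ^ 2) ^ n) =
      ∑' k, ENNReal.ofReal (2 * Real.pi * ‖c k‖ ^ 2) *
        ENNReal.ofReal (r ^ (2 * k + 1) * (1 - r ^ 2) ^ n) := by
    intro r hr
    have h1r : 0 ≤ (1 - r ^ 2) := by nlinarith [hr.1, hr.2]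
    have hr0 := hr.1
    have hin : ∀ θ : ℝ, ‖(r : ℂ) * Complex.exp (θ * Complex.I)‖ = r := by
      intro θ
      rw [norm_mul, Complex.norm_exp_ofReal_mul_I, mul_one, Complex.norm_of_nonneg hr.1.le]
    have hs : Summable fun k => ‖c k * (r : ℂ) ^ k‖ := by
      refine Summable.of_nonneg_of_le (fun k => norm_nonneg _) (fun k => ?_)
        ((summable_geometric_of_lt_one hr.1.le hr.2).mul_left M)
      rw [norm_mul, norm_pow, Complex.norm_of_nonneg hr.1.le]
      exact mul_le_mul_of_nonneg_right (hM k) (by positivity)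
    have he : ∀ θ : ℝ, h (r * Complex.exp (θ * Complex.I)) =
        expSeries (fun k => c k * (r : ℂ) ^ k) θ := by
      intro θ
      rw [← (hsum _ (by rw [hin]; exact hr.2)).tsum_eq, expSeries]
      refine tsum_congr fun k => ?_
      rw [mul_pow, ← Complex.exp_nat_mul, mul_assoc]
      congr 3
      ring
    simp only [hin, he, ENNReal.ofReal_mul (sq_nonneg _)]
    rw [lintegral_mul_const' _ _ ENNReal.ofReal_ne_top, lintegral_sq_expSeries hs,
      ← ENNReal.tsum_mul_right, ← ENNReal.tsum_mul_left]
    refine tsum_congr fun k => ?_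
    rw [← ENNReal.ofReal_mul (by positivity), ← ENNReal.ofReal_mul (by positivity),
      ← ENNReal.ofReal_mul (by positivity), norm_mul, norm_pow, Complex.norm_of_nonneg hr.1.le]
    congr 1
    ring
  rw [setLIntegral_congr_fun measurableSet_Ioo hr, lintegral_tsum (fun k => by fun_prop)]
  refine tsum_congr fun k => ?_
  rw [lintegral_const_mul' _ _ ENNReal.ofReal_ne_top, lintegral_pow_mul_one_sub_sq_pow,
    ← ENNReal.ofReal_mul (by positivity)]
  congr 1
  field_simp

/-! ### Taylor coefficients of functions in `𝒟ₐ` -/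

/-- The `k`-th Taylor coefficient at the origin. -/
noncomputable def taylorCoeff (f : ℂ → ℂ) (k : ℕ) : ℂ := iteratedDeriv k f 0 / k.factorial

lemma differentiableOn_iteratedDeriv (f : DA) (n : ℕ) :
    DifferentiableOn ℂ (iteratedDeriv n (f : ℂ → ℂ)) (Metric.ball 0 1) := by
  intro z hz
  have h3 : AnalyticAt ℂ (f : ℂ → ℂ) z := f.2.1.analyticAt (Metric.isOpen_ball.mem_nhds hz)
  rw [iteratedDeriv_eq_iterate]
  exact (h3.iterated_deriv n).differentiableAt.differentiableWithinAt

lemma derivCoeff_taylorCoeff (f : ℂ → ℂ) (n k : ℕ) :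
    derivCoeff n (taylorCoeff f) k = iteratedDeriv k (iteratedDeriv n f) 0 / k.factorial := by
  have e1 : (k.factorial : ℂ) * (k + n).descFactorial n = (k + n).factorial := by
    have := Nat.factorial_mul_descFactorial (n := k + n) (k := n) (by omega)
    rw [Nat.add_sub_cancel] at this
    exact_mod_cast this
  have e2 : ((k + n).factorial : ℂ) ≠ 0 := by exact_mod_cast (k + n).factorial_ne_zero
  have e3 : (k.factorial : ℂ) ≠ 0 := by exact_mod_cast k.factorial_ne_zero
  have e4 : iteratedDeriv k (iteratedDeriv n f) 0 = iteratedDeriv (k + n) f 0 := by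
    simp only [iteratedDeriv_eq_iterate, Function.iterate_add, Function.comp]
  rw [derivCoeff, taylorCoeff, e4, mul_div_assoc', div_eq_div_iff e2 e3, ← e1]
  ring

lemma hasSum_iteratedDeriv (f : DA) (n : ℕ) {z : ℂ} (hz : ‖z‖ < 1) :
    HasSum (fun k => derivCoeff n (taylorCoeff f) k * z ^ k) (iteratedDeriv n (f : ℂ → ℂ) z) := by
  have h := Complex.hasSum_taylorSeries_on_ball (differentiableOn_iteratedDeriv f n)
    (z := z) (by simpa using hz)
  refine h.congr_fun fun k => ?_
  rw [derivCoeff_taylorCoeff, sub_zero, smul_eq_mul, smul_eq_mul]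
  ring

/-- The Taylor coefficients of a derivative are bounded: Cauchy's estimate for the
`n`-th derivative, on circles of radius tending to `1`. -/
lemma exists_bound_derivCoeff (f : DA) (n : ℕ) :
    ∃ C : ℝ, ∀ k, ‖derivCoeff n (taylorCoeff f) k‖ ≤ C := by
  obtain ⟨C, hC⟩ := exists_bound_iteratedDeriv f n
  refine ⟨C, fun k => ?_⟩
  have hlim : Tendsto (fun R : ℝ => ‖derivCoeff n (taylorCoeff f) k‖ * R ^ k) (𝓝[<] 1)
      (𝓝 (‖derivCoeff n (taylorCoeff f) k‖ * 1 ^ k)) :=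
    ((continuous_const.mul (continuous_pow k)).tendsto 1).mono_left nhdsWithin_le_nhds
  rw [one_pow, mul_one] at hlim
  refine le_of_tendsto hlim ?_
  filter_upwards [Ioo_mem_nhdsLT (zero_lt_one (α := ℝ))] with R hR
  have hsub : Metric.closedBall (0 : ℂ) R ⊆ Metric.ball 0 1 := Metric.closedBall_subset_ball hR.2
  have h := Complex.norm_iteratedDeriv_le_of_forall_mem_sphere_norm_le (c := 0) k hR.1
    (((differentiableOn_iteratedDeriv f n).mono hsub).diffContOnCl_ball subset_rfl)
    (fun z hz => hC z (hsub (Metric.sphere_subset_closedBall hz)))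
  have hk : (0 : ℝ) < k.factorial := by positivity
  have hRk : 0 < R ^ k := pow_pos hR.1 k
  rw [derivCoeff_taylorCoeff, norm_div, Complex.norm_natCast, ← le_div_iff₀ hRk, div_le_iff₀ hk]
  refine h.trans (le_of_eq ?_)
  ring

lemma rapidDecay_taylorCoeff (f : DA) : RapidDecay (taylorCoeff f) := by
  intro p
  obtain ⟨C, hC⟩ := exists_bound_derivCoeff f (p + 2)
  have h2 : Summable fun k : ℕ => 1 / ((k : ℝ) + 1) ^ 2 := by
    have := (summable_nat_add_iff 1).2 (Real.summable_one_div_nat_pow.2 (one_lt_two))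
    simpa using this
  rw [← summable_nat_add_iff (p + 2)]
  refine Summable.of_nonneg_of_le (fun k => by positivity) (fun k => ?_)
    (h2.mul_left (((p : ℝ) + 3) ^ p * C))
  have h1 := hC k
  rw [derivCoeff, norm_mul, Complex.norm_natCast] at h1
  have h3 : ((k : ℝ) + 1) ^ (p + 2) ≤ ((k + (p + 2)).descFactorial (p + 2) : ℕ) := by
    have := Nat.pow_sub_le_descFactorial (k + (p + 2)) (p + 2)
    rw [show k + (p + 2) + 1 - (p + 2) = k + 1 by omega] at this
    exact_mod_cast this
  have h4 : (((k + (p + 2) : ℕ) : ℝ) + 1) ≤ ((p : ℝ) + 3) * ((k : ℝ) + 1) := by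
    push_cast
    nlinarith [(Nat.cast_nonneg p : (0 : ℝ) ≤ p), (Nat.cast_nonneg k : (0 : ℝ) ≤ k),
      mul_nonneg (Nat.cast_nonneg p : (0 : ℝ) ≤ p) (Nat.cast_nonneg k : (0 : ℝ) ≤ k)]
  rw [mul_one_div, le_div_iff₀ (by positivity)]
  calc (((k + (p + 2) : ℕ) : ℝ) + 1) ^ p * ‖taylorCoeff f (k + (p + 2))‖ * ((k : ℝ) + 1) ^ 2
      ≤ (((p : ℝ) + 3) * ((k : ℝ) + 1)) ^ p * ‖taylorCoeff f (k + (p + 2))‖ *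
        ((k : ℝ) + 1) ^ 2 := by gcongr
    _ = ((p : ℝ) + 3) ^ p * (((k : ℝ) + 1) ^ (p + 2) * ‖taylorCoeff f (k + (p + 2))‖) := by
        rw [mul_pow]; ring
    _ ≤ ((p : ℝ) + 3) ^ p * C := by
        gcongr
        exact (mul_le_mul_of_nonneg_right h3 (norm_nonneg _)).trans h1

/-- The Taylor series represents `f` up to the boundary. -/
lemma coeffTail_taylorCoeff_zero (f : DA) (ζ : UnitCircle) :
    coeffTail (taylorCoeff f) ζ 0 = (f : ℂ → ℂ) ζ := by
  have hs := (rapidDecay_taylorCoeff f).summable_norm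
  have hcont : ContinuousOn (fun z : ℂ => ∑' k, taylorCoeff f k * z ^ k)
      (Metric.closedBall 0 1) := by
    refine continuousOn_tsum (fun k => by fun_prop) hs fun k z hz => ?_
    rw [norm_mul, norm_pow]
    exact mul_le_of_le_one_right (norm_nonneg _)
      (pow_le_one₀ (norm_nonneg _) (by simpa using hz))
  have heq : Set.EqOn (fun z : ℂ => ∑' k, taylorCoeff f k * z ^ k) f (Metric.ball 0 1) := by
    intro z hz
    have := (hasSum_iteratedDeriv f 0 (z := z) (by simpa using hz)).tsum_eq
    simpa [derivCoeff] using this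
  have := heq.of_subset_closure hcont f.2.2.continuousOn Metric.ball_subset_closedBall
    (closure_ball (0 : ℂ) one_ne_zero).ge (Metric.sphere_subset_closedBall ζ.2)
  simpa [coeffTail] using this

lemma taylorCoeff_mulZ_succ (f : DA) (k : ℕ) :
    taylorCoeff (mulZ f : DA) (k + 1) = taylorCoeff f k := by
  have h0 : (0 : ℂ) ∈ Metric.ball (0 : ℂ) 1 := by simp
  have h : iteratedDeriv (k + 1) ((mulZ f : DA) : ℂ → ℂ) 0 =
      (k + 1) * iteratedDeriv k (f : ℂ → ℂ) 0 := by
    have h1 : ((mulZ f : DA) : ℂ → ℂ) = fun z => z * (f : ℂ → ℂ) z := rfl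
    rw [h1, iteratedDeriv_fun_mul contDiffAt_fun_id (contDiffAt_of_mem f (k + 1) h0),
      Finset.sum_eq_single 1]
    · simp [iteratedDeriv_one]
    · intro i _ hi
      simp [iteratedDeriv_fun_id_zero, hi]
    · intro hn
      simp at hn
  have hk : ((k : ℂ) + 1) ≠ 0 := by exact_mod_cast k.succ_ne_zero
  have hk' : (k.factorial : ℂ) ≠ 0 := by exact_mod_cast k.factorial_ne_zero
  rw [taylorCoeff, taylorCoeff, h, Nat.factorial_succ]
  push_cast
  field_simp

/-! ### The local Dirichlet integral -/

/-- The local Dirichlet integral of order `n` at a point `ζ` of the circle, in terms of the Taylor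
coefficients: `|f(ζ)|²` for `n = 0`, and `∑ₖ (k choose n - 1) |gₖ|²` for `n ≥ 1`, where
`f = f(ζ) + (z - ζ) ∑ gₖ zᵏ`. -/
noncomputable def localDirichlet (a : ℕ → ℂ) (ζ : ℂ) : ℕ → ENNReal
  | 0 => ENNReal.ofReal (‖coeffTail a ζ 0‖ ^ 2)
  | n + 1 => ∑' k : ℕ, ENNReal.ofReal ((k.choose n : ℝ) * ‖coeffTail a ζ (k + 1)‖ ^ 2)

lemma continuous_coeffTail {a : ℕ → ℂ} (ha : Summable fun k => ‖a k‖) (k : ℕ) :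
    Continuous fun ζ : UnitCircle => coeffTail a ζ k := by
  refine continuous_tsum (fun i => by fun_prop)
    (ha.comp_injective (add_right_injective k)) fun i ζ => ?_
  simp

lemma measurable_localDirichlet {a : ℕ → ℂ} (ha : Summable fun k => ‖a k‖) (n : ℕ) :
    Measurable fun ζ : UnitCircle => localDirichlet a ζ n := by
  have hc := fun k => (continuous_coeffTail ha k).measurable
  cases n with
  | zero => exact ((hc 0).norm.pow_const 2).ennreal_ofReal
  | succ n =>
    exact Measurable.tsum fun k =>
      (((hc (k + 1)).norm.pow_const 2).const_mul _).ennreal_ofReal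

/-- The effect of multiplication by `z`, whose coefficients are those of `a` shifted by one: the
difference quotients are shifted as well, with `f(ζ)` as the new first coefficient, and Pascal's
rule applies. -/
lemma localDirichlet_shift {a b : ℕ → ℂ} (hb : ∀ k, b (k + 1) = a k) (ζ : ℂ) (n : ℕ) :
    localDirichlet b ζ (n + 1) = localDirichlet a ζ (n + 1) + localDirichlet a ζ n := by
  have ht : ∀ k, coeffTail b ζ (k + 1) = coeffTail a ζ k := fun k =>
    tsum_congr fun i => by rw [show k + 1 + i = k + i + 1 by ring, hb]
  cases n with
  | zero =>
    simp only [localDirichlet, ht, Nat.choose_zero_right, Nat.cast_one, one_mul]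
    rw [tsum_eq_zero_add' ENNReal.summable, add_comm]
  | succ n =>
    simp only [localDirichlet, ht]
    rw [tsum_eq_zero_add' ENNReal.summable, ← ENNReal.tsum_add]
    simp only [Nat.choose_zero_succ, Nat.cast_zero, zero_mul, ENNReal.ofReal_zero, zero_add]
    refine tsum_congr fun k => ?_
    rw [← ENNReal.ofReal_add (by positivity) (by positivity), Nat.choose_succ_succ]
    push_cast
    congr 1
    ring

/-- Raising the order costs only a multiple of `|f̂(n)|²`, which bounds the first nonzero term of
order `n` together with the first nonzero term of order `n + 1`. -/
lemma localDirichlet_le {a : ℕ → ℂ} (ha : Summable fun k => ‖a k‖) {ζ : ℂ} (hζ : ‖ζ‖ = 1)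
    (n : ℕ) : localDirichlet a ζ n ≤
      ENNReal.ofReal (2 * ‖a n‖ ^ 2) + ENNReal.ofReal (n + 2) * localDirichlet a ζ (n + 1) := by
  have hsq : ∀ k, ‖coeffTail a ζ k‖ ^ 2 ≤ 2 * ‖a k‖ ^ 2 + 2 * ‖coeffTail a ζ (k + 1)‖ ^ 2 := by
    intro k
    have h : ‖coeffTail a ζ k‖ ≤ ‖a k‖ + ‖coeffTail a ζ (k + 1)‖ := by
      rw [coeffTail_eq_add ha hζ k]
      refine (norm_add_le _ _).trans (le_of_eq ?_)
      rw [norm_mul, hζ, one_mul]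
    nlinarith [norm_nonneg (coeffTail a ζ k), sq_nonneg (‖a k‖ - ‖coeffTail a ζ (k + 1)‖)]
  -- the term `k = n` of the series of order `n + 1`
  have hterm : ENNReal.ofReal (‖coeffTail a ζ (n + 1)‖ ^ 2) ≤ localDirichlet a ζ (n + 1) := by
    refine le_trans (le_of_eq ?_) (ENNReal.le_tsum n)
    simp
  have hn : ENNReal.ofReal (‖coeffTail a ζ n‖ ^ 2) ≤
      ENNReal.ofReal (2 * ‖a n‖ ^ 2) + ENNReal.ofReal 2 * localDirichlet a ζ (n + 1) := by
    refine (ENNReal.ofReal_le_ofReal (hsq n)).trans ?_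
    rw [ENNReal.ofReal_add (by positivity) (by positivity),
      ENNReal.ofReal_mul (q := ‖coeffTail a ζ (n + 1)‖ ^ 2) zero_le_two]
    gcongr
  cases n with
  | zero => simpa [localDirichlet] using hn
  | succ n =>
    have hle : localDirichlet a ζ (n + 1) ≤ ENNReal.ofReal (n + 1) * localDirichlet a ζ (n + 2) +
        ENNReal.ofReal (‖coeffTail a ζ (n + 1)‖ ^ 2) := by
      rw [← tsum_ite_eq n (fun _ => ENNReal.ofReal (‖coeffTail a ζ (n + 1)‖ ^ 2)), localDirichlet,
        localDirichlet, ← ENNReal.tsum_mul_left, ← ENNReal.tsum_add]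
      refine ENNReal.tsum_le_tsum fun k => ?_
      rcases lt_trichotomy k n with hk | rfl | hk
      · simp [Nat.choose_eq_zero_of_lt hk]
      · simp
      · rw [if_neg hk.ne', add_zero, ← ENNReal.ofReal_mul (by positivity), ← mul_assoc]
        refine ENNReal.ofReal_le_ofReal (mul_le_mul_of_nonneg_right ?_ (by positivity))
        have h1 : k.choose n ≤ k.choose (n + 1) * (n + 1) := by
          rw [Nat.choose_succ_right_eq]
          exact Nat.le_mul_of_pos_right _ (by omega)
        have h2 : (k.choose n : ℝ) ≤ k.choose (n + 1) * (n + 1) := by exact_mod_cast h1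
        linarith
    refine hle.trans ((add_le_add le_rfl hn).trans (le_of_eq ?_))
    rw [show ((n + 1 : ℕ) : ℝ) + 2 = ((n : ℝ) + 1) + 2 by push_cast; ring,
      ENNReal.ofReal_add (by positivity : (0 : ℝ) ≤ (n : ℝ) + 1) zero_le_two]
    ring

/-- Local Douglas formula: the weighted Dirichlet integral with weight the Poisson kernel at `ζ`. -/
lemma lintegral_poissonKernel_eq (f : DA) (ζ : UnitCircle) (n : ℕ) :
    ∫⁻ z in Metric.ball (0 : ℂ) 1, ENNReal.ofReal
      (1 / ((n + 1).factorial * n.factorial * Real.pi) * (poissonKernel 0 z (ζ : ℂ) *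
        (1 - ‖z‖ ^ 2) ^ n * ‖iteratedDeriv (n + 1) (f : ℂ → ℂ) z‖ ^ 2)) =
      localDirichlet (taylorCoeff f) ζ (n + 1) := by
  have hpi := Real.pi_pos
  have hζ : ‖(ζ : ℂ)‖ = 1 := by simp
  have hcc : ‖conj (ζ : ℂ)‖ = 1 := by simp
  have ha := rapidDecay_taylorCoeff f
  have hb := ha.summable_derivCoeff (n + 1)
  have hne : ∀ z ∈ Metric.ball (0 : ℂ) 1, 1 - conj (ζ : ℂ) * z ≠ 0 := by
    intro z hz h
    have h1 : ‖conj (ζ : ℂ) * z‖ = 1 := by rw [← sub_eq_zero.1 h, norm_one]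
    rw [norm_mul, hcc, one_mul] at h1
    have : ‖z‖ < 1 := by simpa using hz
    linarith
  have hB := lintegral_bergman
    (h := fun z => iteratedDeriv (n + 1) (f : ℂ → ℂ) z / (1 - conj (ζ : ℂ) * z))
    (fun k => norm_geomConv_le hb hcc k)
    ((continuousOn_iteratedDeriv f (n + 1)).div (by fun_prop) hne)
    (fun z hz => by
      have := hasSum_geomConv hb hcc hz
      rwa [(hasSum_iteratedDeriv f (n + 1) hz).tsum_eq] at this) (n + 1)
  have hpt : ∀ z ∈ Metric.ball (0 : ℂ) 1, ENNReal.ofReal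
      (1 / ((n + 1).factorial * n.factorial * Real.pi) * (poissonKernel 0 z (ζ : ℂ) *
        (1 - ‖z‖ ^ 2) ^ n * ‖iteratedDeriv (n + 1) (f : ℂ → ℂ) z‖ ^ 2)) =
      ENNReal.ofReal (1 / ((n + 1).factorial * n.factorial * Real.pi)) *
      ENNReal.ofReal (‖iteratedDeriv (n + 1) (f : ℂ → ℂ) z / (1 - conj (ζ : ℂ) * z)‖ ^ 2 *
        (1 - ‖z‖ ^ 2) ^ (n + 1)) := by
    intro z hz
    rw [← ENNReal.ofReal_mul (by positivity)]
    congr 2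
    have h1 : ‖(ζ : ℂ) - z‖ = ‖1 - conj (ζ : ℂ) * z‖ := by
      have h2 : conj (ζ : ℂ) * (ζ - z) = 1 - conj (ζ : ℂ) * z := by
        rw [mul_sub, Complex.conj_mul', hζ]
        simp
      rw [← h2, norm_mul, hcc, one_mul]
    simp only [poissonKernel_def, sub_zero, hζ, h1, norm_div, div_pow]
    ring
  rw [setLIntegral_congr_fun Metric.isOpen_ball.measurableSet hpt,
    lintegral_const_mul' _ _ ENNReal.ofReal_ne_top, hB]
  have hfin := tsum_geomConv_eq ha hζ n
  have hn : ENNReal.ofReal (1 / (n.factorial : ℝ)) * ENNReal.ofReal n.factorial = 1 := by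
    rw [← ENNReal.ofReal_mul (by positivity), one_div_mul_cancel (by positivity),
      ENNReal.ofReal_one]
  rw [← one_mul (localDirichlet _ _ _), localDirichlet, ← hn,
    mul_assoc (ENNReal.ofReal (1 / (n.factorial : ℝ))), ← hfin,
    ← ENNReal.tsum_mul_left, ← ENNReal.tsum_mul_left]
  refine tsum_congr fun k => ?_
  rw [← ENNReal.ofReal_mul (by positivity), ← ENNReal.ofReal_mul (by positivity)]
  congr 1
  rw [show k + (n + 1) + 1 = k + n + 2 by ring]
  field_simp

lemma ofReal_poissonExtension (μ : FiniteMeasure UnitCircle) {z : ℂ} (hz : ‖z‖ < 1) :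
    ENNReal.ofReal (poissonExtension μ z) =
      ∫⁻ ζ : UnitCircle, ENNReal.ofReal (poissonKernel 0 z (ζ : ℂ)) ∂(μ : Measure UnitCircle) := by
  have hm : Measurable fun ζ : UnitCircle => poissonKernel 0 z (ζ : ℂ) := by
    simp only [poissonKernel_def]
    fun_prop
  refine ofReal_integral_eq_lintegral_ofReal ?_
    (Eventually.of_forall fun ζ => (norm_le_poissonKernel hz (by simp)).1)
  refine Integrable.of_bound hm.aestronglyMeasurable (2 * (1 - ‖z‖) ^ (-1 : ℝ))
    (Eventually.of_forall fun ζ => ?_)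
  obtain ⟨h1, h2⟩ := norm_le_poissonKernel hz (ζ := ζ) (by simp)
  rw [Real.norm_of_nonneg h1]
  refine h2.trans ?_
  have h3 : 1 - ‖z‖ ≤ ‖z - ζ‖ := by
    have := norm_sub_norm_le (ζ : ℂ) z
    rw [norm_sub_rev] at this
    simpa using this
  have h4 : 0 < 1 - ‖z‖ := by linarith
  rw [Real.rpow_neg_one, Real.rpow_neg_one]
  gcongr

lemma dirichletIntegral_nonneg (μ : FiniteMeasure UnitCircle) (n : ℕ) (f : DA) :
    0 ≤ dirichletIntegral μ n f := by
  rw [dirichletIntegral_eq]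
  exact integral_nonneg fun z => by positivity

/-- Douglas formula: the weighted Dirichlet integral is the average of the local ones. -/
lemma ofReal_dirichletIntegral (μ : FiniteMeasure UnitCircle) (n : ℕ) (f : DA) :
    ENNReal.ofReal (dirichletIntegral μ n f) =
      ∫⁻ ζ : UnitCircle, localDirichlet (taylorCoeff f) ζ n ∂(μ : Measure UnitCircle) := by
  cases n with
  | zero =>
    simp only [dirichletIntegral, localDirichlet, coeffTail_taylorCoeff_zero]
    refine ofReal_integral_eq_lintegral_ofReal ?_ (Eventually.of_forall fun ζ => by positivity)
    exact (((continuous_restrict_circle f).norm.pow 2).integrable_of_hasCompactSupport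
      (HasCompactSupport.of_compactSpace _))
  | succ n =>
    have hpi := Real.pi_pos
    have hF : AEMeasurable (iteratedDeriv (n + 1) (f : ℂ → ℂ))
        (volume.restrict (Metric.ball 0 1)) :=
      (continuousOn_iteratedDeriv f (n + 1)).aemeasurable Metric.isOpen_ball.measurableSet
    rw [dirichletIntegral_eq, ofReal_integral_eq_lintegral_ofReal
      ((memLp_iteratedDeriv μ (n + 1) f).integrable_norm_pow (by simp))
      (Eventually.of_forall fun z => by positivity), weightMeasure,
      lintegral_withDensity_eq_lintegral_mul_non_measurable _
        (measurable_weight μ n).ennreal_ofReal (by simp)]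
    have hpt : ∀ z ∈ Metric.ball (0 : ℂ) 1,
        ((fun z => ENNReal.ofReal (1 / ((n + 1).factorial * n.factorial * Real.pi) *
          (poissonExtension μ z * (1 - ‖z‖ ^ 2) ^ n))) *
          fun z => ENNReal.ofReal (‖iteratedDeriv (n + 1) (f : ℂ → ℂ) z‖ ^ 2)) z =
        ∫⁻ ζ : UnitCircle, ENNReal.ofReal
          (1 / ((n + 1).factorial * n.factorial * Real.pi) * (poissonKernel 0 z (ζ : ℂ) *
          (1 - ‖z‖ ^ 2) ^ n * ‖iteratedDeriv (n + 1) (f : ℂ → ℂ) z‖ ^ 2))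
          ∂(μ : Measure UnitCircle) := by
      intro z hz
      have hz' : ‖z‖ < 1 := by simpa using hz
      have h1 : 0 ≤ 1 - ‖z‖ ^ 2 := by nlinarith [norm_nonneg z]
      have h2 := poissonExtension_nonneg μ hz'
      have h3 : ∀ ζ : UnitCircle, ENNReal.ofReal
          (1 / ((n + 1).factorial * n.factorial * Real.pi) * (poissonKernel 0 z (ζ : ℂ) *
          (1 - ‖z‖ ^ 2) ^ n * ‖iteratedDeriv (n + 1) (f : ℂ → ℂ) z‖ ^ 2)) =
          ENNReal.ofReal (poissonKernel 0 z (ζ : ℂ)) * ENNReal.ofReal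
          (1 / ((n + 1).factorial * n.factorial * Real.pi) *
          ((1 - ‖z‖ ^ 2) ^ n * ‖iteratedDeriv (n + 1) (f : ℂ → ℂ) z‖ ^ 2)) := by
        intro ζ
        rw [← ENNReal.ofReal_mul (norm_le_poissonKernel hz' (by simp)).1]
        congr 1
        ring
      simp only [h3]
      rw [lintegral_mul_const' _ _ ENNReal.ofReal_ne_top, ← ofReal_poissonExtension μ hz',
        ← ENNReal.ofReal_mul h2, Pi.mul_apply, ← ENNReal.ofReal_mul (by positivity)]
      congr 1
      ring
    rw [setLIntegral_congr_fun Metric.isOpen_ball.measurableSet hpt, lintegral_lintegral_swap]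
    · exact lintegral_congr fun ζ => lintegral_poissonKernel_eq f ζ n
    · refine AEMeasurable.ennreal_ofReal (AEMeasurable.const_mul ?_ _)
      refine AEMeasurable.mul ?_ ((hF.comp_fst).norm.pow_const 2)
      refine (measurable_poissonKernel.mul ?_).aemeasurable
      fun_prop

/-! ### Multiplication by `z` and the Dirichlet integrals -/

lemma dirichletIntegral_mulZ_zero (μ : FiniteMeasure UnitCircle) (f : DA) :
    dirichletIntegral μ 0 (mulZ f : DA) = dirichletIntegral μ 0 f := by
  have h : ((mulZ f : DA) : ℂ → ℂ) = fun z => z * (f : ℂ → ℂ) z := rfl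
  simp [dirichletIntegral, h]

lemma dirichletIntegral_mulZ_succ (μ : FiniteMeasure UnitCircle) (n : ℕ) (f : DA) :
    dirichletIntegral μ (n + 1) (mulZ f : DA) =
      dirichletIntegral μ (n + 1) f + dirichletIntegral μ n f := by
  have h0 := dirichletIntegral_nonneg μ
  rw [← ENNReal.ofReal_eq_ofReal_iff (h0 _ _) (add_nonneg (h0 _ _) (h0 _ _)),
    ENNReal.ofReal_add (h0 _ _) (h0 _ _)]
  simp only [ofReal_dirichletIntegral, localDirichlet_shift (taylorCoeff_mulZ_succ f)]
  exact lintegral_add_left (measurable_localDirichlet (rapidDecay_taylorCoeff f).summable_norm _) _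

lemma dirichletIntegral_le (μ : FiniteMeasure UnitCircle) (n : ℕ) (f : DA) :
    dirichletIntegral μ n f ≤ 2 * (μ : Measure UnitCircle).real Set.univ * ‖taylorCoeff f n‖ ^ 2 +
      (n + 2) * dirichletIntegral μ (n + 1) f := by
  have h0 := dirichletIntegral_nonneg μ
  have h1 := h0 (n + 1) f
  rw [← ENNReal.ofReal_le_ofReal_iff (by positivity), ENNReal.ofReal_add (by positivity)
    (by positivity), ENNReal.ofReal_mul (p := (n : ℝ) + 2) (by positivity),
    ofReal_dirichletIntegral, ofReal_dirichletIntegral]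
  have hs := (rapidDecay_taylorCoeff f).summable_norm
  refine (lintegral_mono fun ζ : UnitCircle =>
    localDirichlet_le hs (ζ := ζ) (by simp) n).trans (le_of_eq ?_)
  rw [lintegral_add_left measurable_const, lintegral_const,
    lintegral_const_mul' _ _ ENNReal.ofReal_ne_top]
  congr 1
  rw [mul_right_comm, ENNReal.ofReal_mul (p := 2 * ‖taylorCoeff f n‖ ^ 2) (by positivity),
    ofReal_measureReal]

/-! ### The backward shift and bounds for Taylor coefficients -/

lemma dslope_mem_DA (f : DA) : dslope (f : ℂ → ℂ) 0 ∈ DA := by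
  refine ⟨?_, ?_⟩
  · exact (Complex.differentiableOn_dslope (Metric.ball_mem_nhds 0 one_pos)).2 f.2.1
  · intro x hx
    by_cases hx0 : x = 0
    · -- near the origin the function is analytic
      have hd : DifferentiableOn ℂ (dslope (f : ℂ → ℂ) 0) (Metric.ball 0 1) :=
        (Complex.differentiableOn_dslope (Metric.ball_mem_nhds 0 one_pos)).2 f.2.1
      have ha := hd.analyticAt (z := x) (by
        rw [hx0]
        exact Metric.ball_mem_nhds 0 one_pos)
      exact (ha.contDiffAt.restrict_scalars ℝ).contDiffWithinAt
    · have h1 : ContDiffWithinAt ℝ ∞ (fun z : ℂ => z⁻¹ * ((f : ℂ → ℂ) z - (f : ℂ → ℂ) 0))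
          (Metric.closedBall 0 1) x :=
        (contDiffWithinAt_id.inv hx0).mul ((f.2.2 x hx).sub contDiffWithinAt_const)
      have h2 : dslope (f : ℂ → ℂ) 0 =ᶠ[𝓝 x] fun z => z⁻¹ * ((f : ℂ → ℂ) z - (f : ℂ → ℂ) 0) := by
        filter_upwards [isOpen_ne.mem_nhds hx0] with z hz
        rw [dslope_of_ne _ hz, slope_def_field]
        field_simp
        simp
      exact h1.congr_of_eventuallyEq (h2.filter_mono nhdsWithin_le_nhds) h2.self_of_nhds

/-- The backward shift `(f(z) - f(0)) / z` on `𝒟ₐ`. -/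
noncomputable def backwardShift (f : DA) : DA := ⟨dslope (f : ℂ → ℂ) 0, dslope_mem_DA f⟩

lemma mul_backwardShift (f : DA) (z : ℂ) :
    z * (backwardShift f : ℂ → ℂ) z = (f : ℂ → ℂ) z - (f : ℂ → ℂ) 0 := by
  simpa [backwardShift] using sub_smul_dslope (f : ℂ → ℂ) 0 z

lemma taylorCoeff_backwardShift (f : DA) (k : ℕ) :
    taylorCoeff (backwardShift f) k = taylorCoeff f (k + 1) := by
  have h : (f : ℂ → ℂ) = fun z => (f : ℂ → ℂ) 0 + ((mulZ (backwardShift f) : DA) : ℂ → ℂ) z := by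
    funext z
    rw [show ((mulZ (backwardShift f) : DA) : ℂ → ℂ) z = z * (backwardShift f : ℂ → ℂ) z from rfl,
      mul_backwardShift]
    ring
  rw [← taylorCoeff_mulZ_succ, taylorCoeff, taylorCoeff]
  congr 1
  conv_rhs => rw [h]
  rw [iteratedDeriv_const_add (Nat.succ_pos k)]

lemma integrable_sq_circle (μ : FiniteMeasure UnitCircle) (f : DA) :
    Integrable (fun ζ : UnitCircle => ‖(f : ℂ → ℂ) ζ‖ ^ 2) (μ : Measure UnitCircle) :=
  ((continuous_restrict_circle f).norm.pow 2).integrable_of_hasCompactSupport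
    (HasCompactSupport.of_compactSpace _)

lemma dirichletIntegral_zero_backwardShift_le (μ : FiniteMeasure UnitCircle) (f : DA) :
    dirichletIntegral μ 0 (backwardShift f) ≤ 2 * dirichletIntegral μ 0 f +
      2 * (μ : Measure UnitCircle).real Set.univ * ‖taylorCoeff f 0‖ ^ 2 := by
  have h : ∀ ζ : UnitCircle, ‖(backwardShift f : ℂ → ℂ) ζ‖ ^ 2 ≤
      2 * ‖(f : ℂ → ℂ) ζ‖ ^ 2 + 2 * ‖(f : ℂ → ℂ) 0‖ ^ 2 := by
    intro ζ
    have h1 : ‖(backwardShift f : ℂ → ℂ) ζ‖ = ‖(f : ℂ → ℂ) ζ - (f : ℂ → ℂ) 0‖ := by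
      rw [← mul_backwardShift, norm_mul]
      simp
    have h2 := norm_sub_le ((f : ℂ → ℂ) ζ) ((f : ℂ → ℂ) 0)
    rw [h1]
    nlinarith [norm_nonneg ((f : ℂ → ℂ) ζ - (f : ℂ → ℂ) 0),
      sq_nonneg (‖(f : ℂ → ℂ) ζ‖ - ‖(f : ℂ → ℂ) 0‖)]
  have hi := (integrable_sq_circle μ f).const_mul 2
  refine (integral_mono (integrable_sq_circle μ _) (hi.add (integrable_const _)) h).trans
    (le_of_eq ?_)
  rw [integral_add' hi (integrable_const _), integral_const_mul, integral_const]
  simp only [dirichletIntegral, taylorCoeff, iteratedDeriv_zero, Nat.factorial_zero, Nat.cast_one,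
    div_one, smul_eq_mul]
  ring

lemma fourierCoefficient_zero (f : DA) : fourierCoefficient f 0 = taylorCoeff f 0 := by
  have hd : DiffContOnCl ℂ (f : ℂ → ℂ) (Metric.ball 0 |1|) := by
    rw [abs_one]
    exact ⟨f.2.1, by
      rw [closure_ball _ one_ne_zero]
      exact f.2.2.continuousOn⟩
  have h := hd.circleAverage
  simp only [fourierCoefficient, zpow_zero, mul_one, taylorCoeff, iteratedDeriv_zero,
    Nat.factorial_zero, Nat.cast_one, div_one]
  rw [← h, Real.circleAverage]
  simp [circleMap]

/-- If evaluation at the origin is bounded in `L²(μ)`, then so are all Taylor coefficients: apply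
the hypothesis to iterated backward shifts. -/
lemma exists_bound_taylorCoeff {μ : FiniteMeasure UnitCircle}
    (h : ∃ C : ℝ, 0 < C ∧ ∀ f ∈ DA, ‖fourierCoefficient f 0‖ ^ 2 ≤ C * dirichletIntegral μ 0 f)
    (k : ℕ) :
    ∃ C : ℝ, 0 ≤ C ∧ ∀ f : DA, ‖taylorCoeff f k‖ ^ 2 ≤ C * dirichletIntegral μ 0 f := by
  obtain ⟨C, hC, hb⟩ := h
  have hb0 : ∀ f : DA, ‖taylorCoeff f 0‖ ^ 2 ≤ C * dirichletIntegral μ 0 f := fun f => by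
    rw [← fourierCoefficient_zero]
    exact hb f f.2
  induction k with
  | zero => exact ⟨C, hC.le, hb0⟩
  | succ k ih =>
    obtain ⟨B, hB, hk⟩ := ih
    refine ⟨B * (2 + 2 * (μ : Measure UnitCircle).real Set.univ * C), by positivity, fun f => ?_⟩
    rw [← taylorCoeff_backwardShift]
    refine (hk _).trans ?_
    rw [mul_assoc]
    refine mul_le_mul_of_nonneg_left ((dirichletIntegral_zero_backwardShift_le μ f).trans ?_) hB
    have := mul_le_mul_of_nonneg_left (hb0 f)
      (by positivity : 0 ≤ 2 * (μ : Measure UnitCircle).real Set.univ)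
    linarith

/-! ### Allowability -/

lemma dirichletIntegral_le_normSq {m : ℕ} (μ : Fin m → FiniteMeasure UnitCircle) (n : Fin m)
    (f : DA) : dirichletIntegral (μ n) n f ≤ normSq μ f :=
  Finset.single_le_sum (f := fun n : Fin m => dirichletIntegral (μ n) n f)
    (fun _ _ => dirichletIntegral_nonneg _ _ f) (Finset.mem_univ n)

lemma exists_bound_dirichletIntegral_mulZ {m : ℕ} (hm : 0 < m)
    (μ : Fin m → FiniteMeasure UnitCircle) (h0 : 2 ≤ m → ∃ C : ℝ, 0 < C ∧ ∀ f ∈ DA,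
      ‖fourierCoefficient f 0‖ ^ 2 ≤ C * dirichletIntegral (μ ⟨0, hm⟩) 0 f) (n : Fin m) :
    ∃ K : ℝ, 0 ≤ K ∧ ∀ f : DA, dirichletIntegral (μ n) n (mulZ f : DA) ≤ K * normSq μ f := by
  obtain ⟨n, hn⟩ := n
  cases n with
  | zero =>
    refine ⟨1, zero_le_one, fun f => ?_⟩
    rw [one_mul, dirichletIntegral_mulZ_zero]
    exact dirichletIntegral_le_normSq μ ⟨0, hn⟩ f
  | succ n =>
    obtain ⟨B, hB, hb⟩ := exists_bound_taylorCoeff (h0 (by omega)) n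
    set ν := μ ⟨n + 1, hn⟩
    refine ⟨(n + 3) + 2 * (ν : Measure UnitCircle).real Set.univ * B, by positivity, fun f => ?_⟩
    have h1 : dirichletIntegral ν (n + 1) f ≤ normSq μ f :=
      dirichletIntegral_le_normSq μ ⟨n + 1, hn⟩ f
    have h2 := dirichletIntegral_le_normSq μ ⟨0, hm⟩ f
    have h3 := dirichletIntegral_le ν n f
    have h4 := mul_le_mul_of_nonneg_left ((hb f).trans (mul_le_mul_of_nonneg_left h2 hB))
      (by positivity : 0 ≤ 2 * (ν : Measure UnitCircle).real Set.univ)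
    have h5 := mul_le_mul_of_nonneg_left h1 (by positivity : (0 : ℝ) ≤ n + 3)
    simp only [dirichletIntegral_mulZ_succ]
    linarith

lemma allowable_of_bound {m : ℕ} (hm : 0 < m) (μ : Fin m → FiniteMeasure UnitCircle)
    (h0 : 2 ≤ m → ∃ C : ℝ, 0 < C ∧ ∀ f ∈ DA,
      ‖fourierCoefficient f 0‖ ^ 2 ≤ C * dirichletIntegral (μ ⟨0, hm⟩) 0 f) :
    Allowable μ := by
  choose K hK hb using exists_bound_dirichletIntegral_mulZ hm μ h0
  have hS : 0 ≤ ∑ n, K n := Finset.sum_nonneg fun n _ => hK n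
  refine ⟨(∑ n, K n) + 1, by positivity, fun f => ⟨normSq_nonneg μ _, ?_⟩⟩
  have h1 : normSq μ (mulZ f : DA) ≤ (∑ n, K n) * normSq μ f := by
    rw [Finset.sum_mul]
    exact Finset.sum_le_sum fun n _ => hb n f
  refine h1.trans (mul_le_mul_of_nonneg_right ?_ (normSq_nonneg μ f))
  nlinarith

/-! ### The model operator -/

lemma normSq_le_normSq_mulZ {m : ℕ} (μ : Fin m → FiniteMeasure UnitCircle) (f : DA) :
    normSq μ f ≤ normSq μ (mulZ f : DA) := by
  refine Finset.sum_le_sum fun n _ => ?_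
  obtain ⟨n, hn⟩ := n
  cases n with
  | zero => exact (dirichletIntegral_mulZ_zero _ f).ge
  | succ n =>
    have := dirichletIntegral_nonneg (μ ⟨n + 1, hn⟩) n f
    simp only [dirichletIntegral_mulZ_succ]
    linarith

lemma norm_le_norm_modelOperator {m : ℕ} {μ : Fin m → FiniteMeasure UnitCircle} (h : Allowable μ)
    (x : ModelSpace μ) : ‖x‖ ≤ ‖modelOperator h x‖ := by
  induction x using UniformSpace.Completion.induction_on with
  | hp => exact isClosed_le continuous_norm (modelOperator h).continuous.norm
  | ih x =>
    obtain ⟨f, rfl⟩ := (toPreSpace μ).surjective x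
    rw [modelOperator_coe, UniformSpace.Completion.norm_coe, UniformSpace.Completion.norm_coe,
      ← sq_le_sq₀ (norm_nonneg _) (norm_nonneg _), norm_toPreSpace_sq, norm_toPreSpace_sq]
    exact normSq_le_normSq_mulZ μ f

/-- Each difference in `j` of `j ↦ 𝒟_{μ,n}(zʲ f)` lowers the order by one. -/
lemma fwdDiff_iter_dirichletIntegral (μ : FiniteMeasure UnitCircle) (f : DA) {n k : ℕ}
    (hnk : n < k) :
    (fwdDiff 1)^[k] (fun j : ℕ => dirichletIntegral μ n (mulZ^[j] f : DA)) = 0 := by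
  induction n generalizing k with
  | zero =>
    obtain ⟨k, rfl⟩ := Nat.exists_eq_succ_of_ne_zero hnk.ne'
    have h : fwdDiff 1 (fun j : ℕ => dirichletIntegral μ 0 (mulZ^[j] f : DA)) = 0 := by
      funext j
      simp only [fwdDiff, Function.iterate_succ_apply', dirichletIntegral_mulZ_zero, sub_self,
        Pi.zero_apply]
    rw [Function.iterate_succ_apply, h]
    exact Function.iterate_fixed (by funext; simp [fwdDiff]) k
  | succ n ih =>
    obtain ⟨k, rfl⟩ := Nat.exists_eq_succ_of_ne_zero (by omega : k ≠ 0)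
    have h : fwdDiff 1 (fun j : ℕ => dirichletIntegral μ (n + 1) (mulZ^[j] f : DA)) =
        fun j : ℕ => dirichletIntegral μ n (mulZ^[j] f : DA) := by
      funext j
      simp only [fwdDiff, Function.iterate_succ_apply', dirichletIntegral_mulZ_succ,
        add_sub_cancel_left]
    rw [Function.iterate_succ_apply, h]
    exact ih (by omega)

lemma sum_choose_normSq_eq_zero {m : ℕ} (μ : Fin m → FiniteMeasure UnitCircle) (f : DA) :
    ∑ j ∈ Finset.range (m + 1), (-1 : ℝ) ^ (m - j) * m.choose j * normSq μ (mulZ^[j] f : DA) =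
      0 := by
  simp only [normSq, Finset.mul_sum]
  rw [Finset.sum_comm]
  refine Finset.sum_eq_zero fun n _ => ?_
  have h := congrFun (fwdDiff_iter_dirichletIntegral (μ n) f n.2) 0
  rw [fwdDiff_iter_eq_sum_shift] at h
  simpa using h

lemma inner_beta_self {H : Type*} [NormedAddCommGroup H] [InnerProductSpace ℂ H]
    [CompleteSpace H] (n : ℕ) (T : H →L[ℂ] H) (x : H) :
    inner ℂ x (beta n T x) =
      ((∑ j ∈ Finset.range (n + 1), (-1 : ℝ) ^ (n - j) * n.choose j * ‖(T ^ j) x‖ ^ 2 : ℝ) :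
        ℂ) := by
  rw [beta, sum_apply, inner_sum, Complex.ofReal_sum]
  refine Finset.sum_congr rfl fun j _ => ?_
  rw [smul_apply, inner_smul_right, mul_apply_eq_comp,
    ← ContinuousLinearMap.star_eq_adjoint, ← star_pow, ContinuousLinearMap.star_eq_adjoint,
    ContinuousLinearMap.adjoint_inner_right, inner_self_eq_norm_sq_to_K]
  push_cast
  rfl

lemma modelOperator_pow_coe {m : ℕ} {μ : Fin m → FiniteMeasure UnitCircle} (h : Allowable μ)
    (j : ℕ) (f : DA) : (modelOperator h ^ j) (toPreSpace μ f : ModelSpace μ) =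
      (toPreSpace μ (mulZ^[j] f) : ModelSpace μ) := by
  induction j with
  | zero => rfl
  | succ j ih =>
    rw [pow_succ', mul_apply_eq_comp, ih, modelOperator_coe,
      Function.iterate_succ_apply']

lemma isMIsometry_modelOperator {m : ℕ} {μ : Fin m → FiniteMeasure UnitCircle} (h : Allowable μ) :
    IsMIsometry m (modelOperator h) := by
  have hz : ∀ x : ModelSpace μ, inner ℂ x (beta m (modelOperator h) x) = 0 := by
    intro x
    induction x using UniformSpace.Completion.induction_on with
    | hp =>
      exact isClosed_eq (continuous_id.inner (beta m (modelOperator h)).continuous)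
        continuous_const
    | ih x =>
      obtain ⟨f, rfl⟩ := (toPreSpace μ).surjective x
      rw [inner_beta_self]
      simp only [modelOperator_pow_coe, UniformSpace.Completion.norm_coe, norm_toPreSpace_sq,
        sum_choose_normSq_eq_zero, Complex.ofReal_zero]
  have h1 : (beta m (modelOperator h) : ModelSpace μ →ₗ[ℂ] ModelSpace μ) = 0 :=
    (inner_map_self_eq_zero _).1 fun x => by
      rw [← inner_conj_symm]
      simp [hz x]
  exact ContinuousLinearMap.coe_injective h1

theorem theorem5p6 {m : ℕ} (hm : 1 ≤ m) (μ : Fin m → FiniteMeasure UnitCircle)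
    (hμ : μ ⟨m - 1, by omega⟩ ≠ 0)
    (h0 : 2 ≤ m → ∃ C : ℝ, 0 < C ∧ ∀ f ∈ DA,
      ‖fourierCoefficient f 0‖ ^ 2 ≤ C * dirichletIntegral (μ ⟨0, by omega⟩) 0 f) :
    ∃ h : Allowable μ,
      (∀ x : ModelSpace μ, ‖x‖ ≤ ‖modelOperator h x‖) ∧ IsMIsometry m (modelOperator h) :=
  ⟨allowable_of_bound hm μ h0, norm_le_norm_modelOperator _, isMIsometry_modelOperator _⟩
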